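/- Consider the Bernoulli growth random walk (BGRW) with parameter $p\in(0,1]$: the Markov chain $(T_t,X_t)_{t\ge 0}$ whose states are pairs $(T,x)$, where $T$ is a locally finite tree with $V(T)\subset\mathbb{N}$ and $\mathbb{N}\setminus V(T)$ infinite, and $x\in V(T)$. From the state $(T,x)$ the next state $(T',x')$ is sampled as follows. With probability $p$, $T'$ is obtained from $T$ by adding the new vertex $m=\min(\mathbb{N}\setminus V(T))$ and the edge $\{x,m\}$; otherwise $T'=T$. Then $x'$ is a uniformly chosen neighbour of $x$ in $T'$ (with the convention $x'=x$ if $x$ has no neighbour in $T'$, which can happen only if $T'=T$ has a single vertex). Let $\mathbb{P}_{T_0,x_0,p}$ be the law of the chain started from $(T_0,x_0)$. For a vertex $y$ let $$v(y):=|\{0\le t<+\infty : X_t=y\}|\in\mathbb{N}\cup\{+\infty\}$$ be the total number of visits to $y$. **Lemma.** For every $p_0\in(0,1]$ there exist constants $C,\beta>0$, depending only on $p_0$, such that for all $p\in[p_0,1]$, all initial states $(T_0,x_0)$ and all $y\in V(T_0)$, $$\forall k\ge 0:\quad \mathbb{P}_{T_0,x_0,p}(v(y)\ge k)\le C\,e^{-\beta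 k}$$ and $$\mathbb{P}_{T_0,x_0,p}(v(y)>0)\le C\,e^{-\beta\,\mathrm{dist}_{T_0}(x_0,y)}.$$ In particular (taking $p_0=p$), for each fixed $p\in(0,1]$ both bounds hold with constants that depend only on $p$. -/

import Mathlib

open MeasureTheory ProbabilityTheory

noncomputable section

namespace BGRW

/-- A state of the walk: a locally finite tree `T` whose vertices are natural numbers, with
infinitely many natural numbers left unused, together with a vertex of `T`. -/
@[ext]
structure State where
  /-- The tree, as a graph whose vertex set is a subset of `ℕ`. -/
  tree : (⊤ : SimpleGraph ℕ).Subgraph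
  /-- The position of the walker. -/
  pos : ℕ
  connected : tree.Connected
  acyclic : tree.spanningCoe.IsAcyclic
  finite_neighborSet : ∀ v, (tree.neighborSet v).Finite
  infinite_compl : tree.vertsᶜ.Infinite
  pos_mem : pos ∈ tree.verts

namespace State

variable (s : State)

/-- Graph distance in the tree of the state `s`. -/
def dist (x y : ℕ) : ℕ := s.tree.spanningCoe.dist x y

/-- The least natural number that is not a vertex of the tree. -/
def fresh : ℕ := sInf s.tree.vertsᶜ

theorem fresh_notMem : s.fresh ∉ s.tree.verts := Nat.sInf_mem s.infinite_compl.nonempty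

theorem pos_ne_fresh : s.pos ≠ s.fresh := fun h => s.fresh_notMem (h ▸ s.pos_mem)

/-- The tree of `s` with a new vertex `s.fresh`, joined by an edge to the walker's position. -/
def grownTree : (⊤ : SimpleGraph ℕ).Subgraph :=
  s.tree ⊔ (⊤ : SimpleGraph ℕ).subgraphOfAdj (v := s.pos) (w := s.fresh) s.pos_ne_fresh

theorem grownTree_acyclic : s.grownTree.spanningCoe.IsAcyclic := by
  have h : s.grownTree.spanningCoe = s.tree.spanningCoe ⊔ SimpleGraph.edge s.pos s.fresh := by
    ext a b
    have := s.pos_ne_fresh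
    simp only [grownTree, SimpleGraph.Subgraph.spanningCoe_adj, SimpleGraph.Subgraph.sup_adj,
      SimpleGraph.subgraphOfAdj_adj, SimpleGraph.sup_adj, SimpleGraph.edge_adj, Sym2.eq_iff]
    grind
  rw [h]
  refine s.acyclic.sup_edge_of_not_reachable ?_
  rintro ⟨w⟩
  have hn : ¬ w.reverse.Nil := SimpleGraph.Walk.not_nil_of_ne s.pos_ne_fresh.symm
  exact s.fresh_notMem (s.tree.edge_vert (w.reverse.adj_snd hn))

/-- Add a new leaf at the walker's position, without moving the walker. -/
def grow : State where
  tree := s.grownTree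
  pos := s.pos
  connected := SimpleGraph.Subgraph.connected_sup s.connected.preconnected
    (SimpleGraph.Subgraph.subgraphOfAdj_connected _).preconnected ⟨s.pos, s.pos_mem, by simp⟩
  acyclic := s.grownTree_acyclic
  finite_neighborSet v := by
    rw [grownTree, SimpleGraph.Subgraph.neighborSet_sup]
    refine (s.finite_neighborSet v).union (Set.Finite.subset (Set.toFinite {s.pos, s.fresh}) ?_)
    exact SimpleGraph.neighborSet_subgraphOfAdj_subset _
  infinite_compl := by
    refine (s.infinite_compl.sdiff (Set.toFinite {s.pos, s.fresh})).mono ?_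
    rintro v ⟨hv, hv'⟩ (h | h)
    · exact hv h
    · exact hv' h
  pos_mem := Or.inl s.pos_mem

/-- Move the walker to a given neighbour of its position, without changing the tree. -/
def moveTo (v : s.tree.neighborSet s.pos) : State :=
  { s with
    pos := v
    pos_mem := (s.tree.mem_neighborSet _ _ |>.1 v.2).snd_mem }

/-- The law of the state after the walker jumps to a uniformly chosen neighbour of its position.
If the position has no neighbour (the tree is a single vertex) then the walker stays put. -/
def jump : PMF State :=
  open Classical in
  if h : (s.tree.neighborSet s.pos).Nonempty then
    haveI := h.to_subtype
    haveI := (s.finite_neighborSet s.pos).fintype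
    (PMF.uniformOfFintype (s.tree.neighborSet s.pos)).map s.moveTo
  else PMF.pure s

end State

/- Each one-step law has finite support, so it is a measure on all subsets of the state space;
the set of states carries the discrete σ-algebra. -/
instance : MeasurableSpace State := ⊤

/-- The law of the state after one step: with probability `p` a new leaf is added at the walker's
position, and then the walker jumps to a uniformly chosen neighbour in the resulting tree. -/
def step (p : unitInterval) (s : State) : Measure State :=
  ENNReal.ofReal (p : ℝ) • s.grow.jump.toMeasure + ENNReal.ofReal (1 - (p : ℝ)) • s.jump.toMeasure

instance (p : unitInterval) (s : State) : IsProbabilityMeasure (step p s) where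
  measure_univ := by
    simp [step, ← ENNReal.ofReal_add p.2.1 (sub_nonneg.2 p.2.2)]

/-- The transition kernel of the walk. -/
def kernel (p : unitInterval) : Kernel State State where
  toFun := step p
  measurable' := measurable_from_top

instance (p : unitInterval) : IsMarkovKernel (kernel p) :=
  ⟨fun s => inferInstanceAs (IsProbabilityMeasure (step p s))⟩

/-- The law, on the space of trajectories, of the Markov chain with transition kernel `kernel p`
and initial state `s`. -/
def law (p : unitInterval) (s : State) : Measure (ℕ → State) :=
  Kernel.traj (X := fun _ => State)
    (fun n => (kernel p).comap (fun h : (_ : Finset.Iic n) → State =>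
      h ⟨n, Finset.mem_Iic.2 le_rfl⟩) (measurable_pi_apply _)) 0 (fun _ => s)

instance (p : unitInterval) (s : State) : IsProbabilityMeasure (law p s) := by
  unfold law; infer_instance

/-- The total number of visits of the walker to `y` along the trajectory `ω` (possibly `∞`). -/
def visits (y : ℕ) (ω : ℕ → State) : ℕ∞ := {t : ℕ | (ω t).pos = y}.encard

end BGRW

end

/-!
A vertex which the walker visits over and over grows many leaves. From a vertex with many
children, an exit towards the parent and a visit to a given child are equally likely. Comparing
with the ruin of a fair gambler, before its `M`-th exit the walker is likely to have visited many of
the children `M` times each, and the excursions below distinct children do not influence each other.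
If the walker comes back from `M` excursions below a child with probability at most `1 - δ`, then it
comes back from `M` excursions below the parent with a smaller probability, once the number of
children is large. The bound `1 - δ` therefore reproduces itself, by induction on the tree which is
grown during the excursions, and it is uniform in the initial tree.

Hence a new leaf is left for ever with probability bounded below, and a given neighbour is reached
with probability at most `r < 1`. By the strong Markov property, a vertex at distance `d` is reached
with probability at most `r ^ d`, and the number of visits to a vertex has a geometric tail. All
estimates are made for a finite time horizon, which tends to infinity at the end.
-/

noncomputable section

namespace BGRW

/-! ### A fair gambler -/

/-- The probability that a fair coin shows `j` heads before it shows `m` tails. -/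
def win : ℕ → ℕ → ℝ
  | 0, _ => 1
  | _ + 1, 0 => 0
  | j + 1, m + 1 => (win j (m + 1) + win (j + 1) m) / 2

@[simp] theorem win_zero_left (m : ℕ) : win 0 m = 1 := by simp only [win]

@[simp] theorem win_succ_zero (j : ℕ) : win (j + 1) 0 = 0 := by simp only [win]

theorem win_succ_succ (j m : ℕ) : win (j + 1) (m + 1) = (win j (m + 1) + win (j + 1) m) / 2 := by
  simp only [win]

theorem win_nonneg (j m : ℕ) : 0 ≤ win j m := by
  fun_induction win j m <;> linarith

theorem win_le_one (j m : ℕ) : win j m ≤ 1 := by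
  fun_induction win j m <;> linarith

theorem win_one_right_pos (j : ℕ) : 0 < win j 1 := by
  induction j with
  | zero => simp
  | succ j ih => rw [win_succ_succ, win_succ_zero]; linarith

theorem win_sub_win_succ (j m : ℕ) :
    win j (m + 1) - win (j + 1) (m + 1) = (j + m).choose m / 2 ^ (j + m + 1) := by
  induction j generalizing m with
  | zero =>
    induction m with
    | zero => simp [win_succ_succ]; norm_num
    | succ m ih =>
      rw [win_succ_succ 0 (m + 1)]
      simp only [win_zero_left, zero_add, Nat.choose_self, Nat.cast_one] at ih ⊢
      rw [pow_succ, ← div_div, ← ih]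
      ring
  | succ j ihj =>
    induction m with
    | zero =>
      have h := ihj 0
      simp only [win_succ_succ (j + 1) 0, win_succ_zero, Nat.choose_zero_right] at h ⊢
      rw [show j + 1 + 0 + 1 = j + 0 + 1 + 1 by ring, pow_succ, ← div_div, ← h,
        win_succ_succ j 0, win_succ_zero]
      ring
    | succ m ihm =>
      have h := ihj (m + 1)
      rw [win_succ_succ (j + 1) (m + 1)]
      rw [show j + 1 + (m + 1) + 1 = j + 1 + m + 1 + 1 by ring,
        show j + 1 + (m + 1) = j + 1 + m + 1 by ring, Nat.choose_succ_succ, pow_succ]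
      rw [show j + (m + 1) = j + 1 + m by ring] at h
      rw [Nat.cast_add, ← div_div, add_div (Nat.cast _), ← ihm, ← h, win_succ_succ j (m + 1)]
      ring

theorem win_anti_left (m : ℕ) : Antitone fun j => win j m := by
  refine antitone_nat_of_succ_le fun j => ?_
  cases m with
  | zero => simpa using win_nonneg j 0
  | succ m => exact sub_nonneg.1 (win_sub_win_succ j m ▸ by positivity)

theorem win_add_win_swap {j m : ℕ} (h : 0 < j + m) : win j m + win m j = 1 := by
  induction j, m using win.induct with
  | case1 m =>
    obtain ⟨m, rfl⟩ := Nat.exists_eq_add_one_of_ne_zero (by omega : m ≠ 0)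
    simp
  | case2 j => simp
  | case3 j m ihj ihm =>
    rw [win_succ_succ, win_succ_succ]
    linarith [ihj (by omega), ihm (by omega)]

/-- `win (M - n) m` is harmonic for the walk that raises `n` or lowers `m` with equal chance. -/
theorem win_tsub_add_win_tsub (M n m : ℕ) :
    win (M - (n + 1)) (m + 1) + win (M - n) m = 2 * win (M - n) (m + 1) := by
  rcases h : M - n with _ | j
  · rw [show M - (n + 1) = 0 by omega]; norm_num
  · rw [show M - (n + 1) = j by omega, win_succ_succ]; ring

theorem choose_div_two_pow_antitone (m : ℕ) :
    Antitone fun i => ((m + i + m).choose m : ℝ) / 2 ^ (m + i + m) := by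
  refine antitone_nat_of_succ_le fun i => ?_
  have h : (m + i + m + 1).choose m ≤ 2 * (m + i + m).choose m := by
    have h := Nat.choose_mul_succ_eq (m + i + m) m
    rw [show m + i + m + 1 - m = m + i + 1 by omega] at h
    refine Nat.le_of_mul_le_mul_right (c := m + i + 1) ?_ (by omega)
    nlinarith
  rw [show m + (i + 1) + m = m + i + m + 1 by ring, div_le_div_iff₀ (by positivity) (by positivity),
    pow_succ]
  have : ((m + i + m + 1).choose m : ℝ) ≤ 2 * (m + i + m).choose m := by exact_mod_cast h
  nlinarith [pow_pos (zero_lt_two' ℝ) (m + i + m)]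

theorem half_sub_le_win (m i : ℕ) :
    1 / 2 - i * (m.centralBinom / 2 ^ (2 * m + 1)) ≤ win (m + 1 + i) (m + 1) := by
  induction i with
  | zero =>
    have : win (m + 1) (m + 1) + win (m + 1) (m + 1) = 1 := win_add_win_swap (by omega)
    simp only [Nat.cast_zero, zero_mul, sub_zero, add_zero]
    linarith
  | succ i ih =>
    have h := choose_div_two_pow_antitone m (Nat.zero_le (i + 1))
    have hd := win_sub_win_succ (m + 1 + i) m
    rw [show m + 1 + i + m = m + (i + 1) + m by ring, pow_succ, ← div_div] at hd
    simp only [add_zero, ← two_mul] at h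
    rw [← Nat.centralBinom_eq_two_mul_choose] at h
    rw [pow_succ, ← div_div] at ih ⊢
    rw [← add_assoc]
    push_cast
    linarith

theorem centralBinom_sq_mul_le (m : ℕ) : m.centralBinom ^ 2 * (3 * m + 1) ≤ 16 ^ m := by
  induction m with
  | zero => simp
  | succ m ih =>
    refine Nat.le_of_mul_le_mul_left (c := (m + 1) ^ 2) ?_ (by positivity)
    calc (m + 1) ^ 2 * ((m + 1).centralBinom ^ 2 * (3 * (m + 1) + 1))
        = ((m + 1) * (m + 1).centralBinom) ^ 2 * (3 * m + 4) := by ring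
      _ = m.centralBinom ^ 2 * (4 * (2 * m + 1) ^ 2 * (3 * m + 4)) := by
        rw [Nat.succ_mul_centralBinom_succ]; ring
      _ ≤ m.centralBinom ^ 2 * (16 * (m + 1) ^ 2 * (3 * m + 1)) :=
        Nat.mul_le_mul_left _ (by nlinarith)
      _ = 16 * (m + 1) ^ 2 * (m.centralBinom ^ 2 * (3 * m + 1)) := by ring
      _ ≤ 16 * (m + 1) ^ 2 * 16 ^ m := Nat.mul_le_mul_left _ ih
      _ = (m + 1) ^ 2 * 16 ^ (m + 1) := by ring

theorem exists_quarter_le_win (L : ℕ) : ∃ m, 1 / 4 ≤ win (m + L) m := by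
  refine ⟨2 * L ^ 2 + 1, le_trans ?_ (half_sub_le_win (2 * L ^ 2) L)⟩
  set m := 2 * L ^ 2 with hm
  have h : (2 * L * m.centralBinom) ^ 2 ≤ (4 ^ m) ^ 2 := by
    rw [← pow_mul, mul_comm m 2, pow_mul]
    calc (2 * L * m.centralBinom) ^ 2 = m.centralBinom ^ 2 * (2 * m) := by rw [hm]; ring
      _ ≤ m.centralBinom ^ 2 * (3 * m + 1) := Nat.mul_le_mul_left _ (by omega)
      _ ≤ 16 ^ m := centralBinom_sq_mul_le m
  have h' : (2 * L * m.centralBinom : ℝ) ≤ 4 ^ m := by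
    exact_mod_cast (Nat.pow_le_pow_iff_left two_ne_zero).1 h
  have : (L * (m.centralBinom / 2 ^ (2 * m + 1)) : ℝ) ≤ 1 / 4 := by
    rw [pow_succ, pow_mul, show (2 : ℝ) ^ 2 = 4 by norm_num, ← mul_div_assoc,
      div_le_div_iff₀ (by positivity) (by norm_num)]
    linarith
  linarith

/-! ### Averages over the moves of the walker -/

section Average

variable {E F α : Type*} [AddCommGroup E] [Module ℝ E] [AddCommGroup F] [Module ℝ F] {k : ℕ}

/-- The average of `exit` and all `visit i`: the walker leaves a vertex with `k` children for its
parent, or for one of the children, with equal probabilities. -/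
def departMean (exit : E) (visit : Fin k → E) : E := ((k : ℝ) + 1)⁻¹ • (exit + ∑ i, visit i)

/-- The average of `Φ` over the growth of a vertex whose children carry the data `c`: with
probability `p` it gets a further child, carrying the datum `new`. -/
def growMean (p : unitInterval) (new : α) (Φ : (k : ℕ) → (Fin k → α) → E) (k : ℕ)
    (c : Fin k → α) : E :=
  (1 - p : ℝ) • Φ k c + (p : ℝ) • Φ (k + 1) (Fin.snoc c new : Fin (k + 1) → α)

theorem map_departMean (l : E →ₗ[ℝ] F) (exit : E) (visit : Fin k → E) :
    l (departMean exit visit) = departMean (l exit) fun i => l (visit i) := by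
  simp only [departMean, map_smul, map_add, map_sum]

theorem departMean_apply {ι : Type*} (exit : ι → E) (visit : Fin k → ι → E) (a : ι) :
    departMean exit visit a = departMean (exit a) fun i => visit i a :=
  map_departMean (LinearMap.proj a) exit visit

theorem map_growMean (l : E →ₗ[ℝ] F) (p : unitInterval) (new : α)
    (Φ : (k : ℕ) → (Fin k → α) → E) (c : Fin k → α) :
    l (growMean p new Φ k c) = growMean p new (fun k c => l (Φ k c)) k c := by
  simp only [growMean, map_smul, map_add]

theorem departMean_linearMap_apply (exit : E →ₗ[ℝ] F) (visit : Fin k → E →ₗ[ℝ] F) (x : E) :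
    departMean exit visit x = departMean (exit x) fun i => visit i x :=
  map_departMean (LinearMap.applyₗ x) exit visit

theorem growMean_linearMap_apply (p : unitInterval) (new : α)
    (Φ : (k : ℕ) → (Fin k → α) → E →ₗ[ℝ] F) (c : Fin k → α) (x : E) :
    growMean p new Φ k c x = growMean p new (fun k c => Φ k c x) k c :=
  map_growMean (LinearMap.applyₗ x) p new Φ c

theorem departMean_mem {s : Set E} (hs : Convex ℝ s) {exit : E} {visit : Fin k → E}
    (hexit : exit ∈ s) (hvisit : ∀ i, visit i ∈ s) : departMean exit visit ∈ s := by
  have h : departMean exit visit =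
      ∑ o : Option (Fin k), ((k : ℝ) + 1)⁻¹ • o.elim exit visit := by
    simp only [departMean, Fintype.sum_option, Option.elim, ← Finset.smul_sum, smul_add]
  rw [h]
  refine hs.sum_mem (fun _ _ => by positivity) ?_ ?_
  · simp [field]
  · rintro (_ | i) - <;> simp [hexit, hvisit]

theorem growMean_mem {s : Set E} (hs : Convex ℝ s) {p : unitInterval} {new : α}
    {Φ : (k : ℕ) → (Fin k → α) → E} {c : Fin k → α} (h : Φ k c ∈ s)
    (hsnoc : Φ (k + 1) (Fin.snoc c new : Fin (k + 1) → α) ∈ s) : growMean p new Φ k c ∈ s :=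
  hs h hsnoc (sub_nonneg.2 p.2.2) p.2.1 (by ring)

theorem departMean_le {e b : ℝ} {v : Fin k → ℝ} (he : e ≤ b) (hv : ∀ i, v i ≤ b) :
    departMean e v ≤ b :=
  departMean_mem (convex_Iic b) he hv

theorem growMean_le {p : unitInterval} {new : α} {Φ : (k : ℕ) → (Fin k → α) → ℝ} {c : Fin k → α}
    {b : ℝ} (h : Φ k c ≤ b) (hsnoc : Φ (k + 1) (Fin.snoc c new : Fin (k + 1) → α) ≤ b) :
    growMean p new Φ k c ≤ b :=
  growMean_mem (convex_Iic b) h hsnoc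

theorem departMean_mono {e e' : ℝ} {v v' : Fin k → ℝ} (he : e ≤ e') (hv : ∀ i, v i ≤ v' i) :
    departMean e v ≤ departMean e' v' := by
  simp only [departMean]
  gcongr with i
  exact hv i

theorem growMean_mono {β : Type*} {p : unitInterval} {new : α} {new' : β}
    {Φ : (k : ℕ) → (Fin k → α) → ℝ} {Ψ : (k : ℕ) → (Fin k → β) → ℝ} {c : Fin k → α}
    {c' : Fin k → β} (h : Φ k c ≤ Ψ k c')
    (hsnoc : Φ (k + 1) (Fin.snoc c new : Fin (k + 1) → α) ≤
      Ψ (k + 1) (Fin.snoc c' new' : Fin (k + 1) → β)) :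
    growMean p new Φ k c ≤ growMean p new' Ψ k c' :=
  add_le_add (mul_le_mul_of_nonneg_left h (sub_nonneg.2 p.2.2))
    (mul_le_mul_of_nonneg_left hsnoc p.2.1)

end Average

/-- A monotone linear functional of total mass at most `1`, standing for the integral against a
subprobability. -/
structure IsSubmean {α : Type*} (l : (α → ℝ) →ₗ[ℝ] ℝ) : Prop where
  mono : Monotone l
  map_one_le : l 1 ≤ 1

namespace IsSubmean

variable {α : Type*} {l : (α → ℝ) →ₗ[ℝ] ℝ}

theorem nonneg (hl : IsSubmean l) {f : α → ℝ} (hf : 0 ≤ f) : 0 ≤ l f :=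
  map_zero l ▸ hl.mono hf

theorem zero : IsSubmean (0 : (α → ℝ) →ₗ[ℝ] ℝ) := ⟨fun _ _ _ => le_rfl, zero_le_one⟩

theorem proj (a : α) : IsSubmean (LinearMap.proj a : (α → ℝ) →ₗ[ℝ] ℝ) := ⟨fun _ _ h => h a, le_rfl⟩

theorem bind {β : Type*} {l' : α → (β → ℝ) →ₗ[ℝ] ℝ} (hl : IsSubmean l)
    (hl' : ∀ a, IsSubmean (l' a)) : IsSubmean (l ∘ₗ LinearMap.pi l') :=
  ⟨fun _ _ h => hl.mono fun a => (hl' a).mono h,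
    (hl.mono fun a => (hl' a).map_one_le).trans hl.map_one_le⟩

end IsSubmean

theorem convex_isSubmean (α : Type*) : Convex ℝ {l : (α → ℝ) →ₗ[ℝ] ℝ | IsSubmean l} := by
  intro l hl l' hl' a b ha hb hab
  refine ⟨fun f g h => ?_, ?_⟩
  · exact add_le_add (mul_le_mul_of_nonneg_left (hl.mono h) ha)
      (mul_le_mul_of_nonneg_left (hl'.mono h) hb)
  · calc a * l 1 + b * l' 1 ≤ a * 1 + b * 1 :=
        add_le_add (mul_le_mul_of_nonneg_left hl.map_one_le ha)
          (mul_le_mul_of_nonneg_left hl'.map_one_le hb)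
      _ = 1 := by rw [mul_one, mul_one, hab]

/-! ### Urns -/

/-- The data of an urn: the state `new` of a new child, the effect `visit` of a visit on the state
of the visited child, and the payoff `pay` of a child in its final state. -/
structure UrnRule (α : Type*) where
  /-- The state of a new child. -/
  new : α
  /-- The effect of a visit. -/
  visit : α → α
  /-- The final payoff. -/
  pay : α → ℝ

section Urn

variable {α β : Type*}

/-- The expected payoff (a product over the children) of a vertex whose `k` children have the states
`c` when `m` exits remain. At most `n` departures are made before the next exit, and at most `N`
between later ones; beyond this budget nothing is paid. -/
def urn (p : unitInterval) (rule : UrnRule α) (N : ℕ) :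
    ℕ → ℕ → (k : ℕ) → (Fin k → α) → ℝ
  | 0, _, _, c => ∏ i, rule.pay (c i)
  | _ + 1, 0, _, _ => 0
  | m + 1, n + 1, k, c => growMean p rule.new (fun k c => departMean (urn p rule N m N k c)
      fun i => urn p rule N (m + 1) n k (Function.update c i (rule.visit (c i)))) k c
termination_by m n => (m, n)

/-- The expected payoff of the urn `urn` at the time of a departure, when `m` exits remain after the
next one and the departure, if not an exit, can be followed by `n` others before the next exit. -/
def urnDepart (p : unitInterval) (rule : UrnRule α) (N m n k : ℕ) (c : Fin k → α) : ℝ :=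
  departMean (urn p rule N m N k c)
    fun i => urn p rule N (m + 1) n k (Function.update c i (rule.visit (c i)))

theorem urn_succ_succ (p : unitInterval) (rule : UrnRule α) (N m n k : ℕ) (c : Fin k → α) :
    urn p rule N (m + 1) (n + 1) k c = growMean p rule.new (urnDepart p rule N m n) k c := by
  rw [urn]; rfl

variable {p : unitInterval} {N : ℕ}

theorem urn_le_urn {rule : UrnRule α} {rule' : UrnRule β} (r : α → β → Prop)
    (hnew : r rule.new rule'.new) (hvisit : ∀ a b, r a b → r (rule.visit a) (rule'.visit b))
    (hpay : ∀ a b, r a b → 0 ≤ rule.pay a ∧ rule.pay a ≤ rule'.pay b)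
    (m n : ℕ) {k : ℕ} {c : Fin k → α} {c' : Fin k → β} (h : ∀ i, r (c i) (c' i)) :
    urn p rule N m n k c ≤ urn p rule' N m n k c' := by
  induction m generalizing n k with
  | zero =>
    rw [urn, urn]
    exact Finset.prod_le_prod (fun i _ => (hpay _ _ (h i)).1) fun i _ => (hpay _ _ (h i)).2
  | succ m ihm =>
    induction n generalizing k with
    | zero => rw [urn, urn]
    | succ n ihn =>
      have depart {k : ℕ} {c : Fin k → α} {c' : Fin k → β} (h : ∀ i, r (c i) (c' i)) :
          urnDepart p rule N m n k c ≤ urnDepart p rule' N m n k c' := by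
        refine departMean_mono (ihm N h) fun i => ihn fun j => ?_
        rcases eq_or_ne j i with rfl | hj
        · simpa using hvisit _ _ (h j)
        · simpa [hj] using h j
      rw [urn_succ_succ, urn_succ_succ]
      refine growMean_mono (depart h) (depart ?_)
      exact Fin.forall_fin_succ'.2 ⟨by simpa using h, by simpa using hnew⟩

theorem urn_le_of_superharmonic {rule : UrnRule α} {m₀ : ℕ} {B : ℕ → (k : ℕ) → (Fin k → α) → ℝ}
    (hB0 : ∀ l k c, 0 ≤ B l k c) (hbase : ∀ n k c, urn p rule N m₀ n k c ≤ B 0 k c)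
    (hB : ∀ l k c, growMean p rule.new (fun k c => departMean (B l k c)
      fun i => B (l + 1) k (Function.update c i (rule.visit (c i)))) k c ≤ B (l + 1) k c)
    (l n k : ℕ) (c : Fin k → α) : urn p rule N (m₀ + l) n k c ≤ B l k c := by
  induction l generalizing n k c with
  | zero => exact hbase n k c
  | succ l ihl =>
    rw [← add_assoc]
    induction n generalizing k c with
    | zero => rw [urn]; exact hB0 _ _ _
    | succ n ihn =>
      rw [urn_succ_succ]
      exact (growMean_mono (departMean_mono (ihl _ _ _) fun i => ihn _ _)
        (departMean_mono (ihl _ _ _) fun i => ihn _ _)).trans (hB l k c)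

theorem urn_le_one {rule : UrnRule α} (h0 : ∀ a, 0 ≤ rule.pay a) (h1 : ∀ a, rule.pay a ≤ 1)
    (m n k : ℕ) (c : Fin k → α) : urn p rule N m n k c ≤ 1 := by
  rw [← zero_add m]
  refine urn_le_of_superharmonic (B := fun _ _ _ => 1) (fun _ _ _ => zero_le_one)
    (fun n k c => ?_) (fun _ k c => ?_) m n k c
  · rw [urn]
    exact Finset.prod_le_one (fun i _ => h0 _) fun i _ => h1 _
  · exact growMean_le (departMean_le le_rfl fun _ => le_rfl) (departMean_le le_rfl fun _ => le_rfl)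

/-- Growth halves the weight `(1 / 2) ^ k`, so each departure multiplies it by at most
`1 - p₀ / 2` on average. -/
theorem urn_le_of_growth {rule : UrnRule α} {p₀ θ A : ℝ} {m₀ : ℕ} (hp0 : 0 ≤ p₀) (hp : p₀ ≤ p)
    (hθ0 : 0 ≤ θ) (hθ1 : θ ≤ 1) (hA : 0 ≤ A)
    (hbase : ∀ n k c, urn p rule N m₀ n k c ≤ 1 - θ * (1 - A * (1 / 2) ^ k))
    (l n k : ℕ) (c : Fin k → α) :
    urn p rule N (m₀ + l) n k c ≤ 1 - θ * (1 - A * (1 / 2) ^ k * (1 - p₀ / 2) ^ l) := by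
  have hr0 : 0 ≤ 1 - p₀ / 2 := by linarith [p.2.2]
  have hweight (l k : ℕ) : 0 ≤ θ * (A * (1 / 2) ^ k * (1 - p₀ / 2) ^ l) := by positivity
  refine urn_le_of_superharmonic
    (B := fun l k _ => 1 - θ * (1 - A * (1 / 2) ^ k * (1 - p₀ / 2) ^ l))
    (fun l k _ => by linarith [hweight l k]) (by simpa using hbase) (fun l k c => ?_) l n k c
  have depart (k : ℕ) : departMean (1 - θ * (1 - A * (1 / 2) ^ k * (1 - p₀ / 2) ^ l))
      (fun _ : Fin k => 1 - θ * (1 - A * (1 / 2) ^ k * (1 - p₀ / 2) ^ (l + 1))) ≤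
      1 - θ * (1 - A * (1 / 2) ^ k * (1 - p₀ / 2) ^ l) := by
    refine departMean_le le_rfl fun _ => ?_
    gcongr 1 - _ * (_ - _ * ?_)
    exact pow_le_pow_of_le_one hr0 (by linarith) (Nat.le_succ l)
  calc growMean p rule.new _ k c
      ≤ (1 - p) * (1 - θ * (1 - A * (1 / 2) ^ k * (1 - p₀ / 2) ^ l)) +
        p * (1 - θ * (1 - A * (1 / 2) ^ (k + 1) * (1 - p₀ / 2) ^ l)) :=
        add_le_add (mul_le_mul_of_nonneg_left (depart k) (sub_nonneg.2 p.2.2))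
          (mul_le_mul_of_nonneg_left (depart (k + 1)) p.2.1)
    _ = 1 - θ + (1 - p / 2) * (θ * (A * (1 / 2) ^ k * (1 - p₀ / 2) ^ l)) := by ring
    _ ≤ 1 - θ + (1 - p₀ / 2) * (θ * (A * (1 / 2) ^ k * (1 - p₀ / 2) ^ l)) := by
        gcongr
    _ = 1 - θ * (1 - A * (1 / 2) ^ k * (1 - p₀ / 2) ^ (l + 1)) := by ring

end Urn

/-- The expected number, among the first `J` children, of counters `c i` that will reach `M` before
`m` exits are made, an exit and a visit to a given child being equally likely. -/
def reachSum (M J m : ℕ) {k : ℕ} (c : Fin k → ℕ) : ℝ :=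
  ∑ i : Fin k, if (i : ℕ) < J then win (M - c i) m else 0

section ReachSum

variable {M J m k : ℕ} {c : Fin k → ℕ}

theorem reachSum_nonneg : 0 ≤ reachSum M J m c :=
  Finset.sum_nonneg fun i _ => by split_ifs; exacts [win_nonneg _ _, le_rfl]

theorem reachSum_le : reachSum M J m c ≤ J := by
  have h : Finset.card {i ∈ Finset.range k | i < J} ≤ J := by
    simpa using Finset.card_le_card (t := Finset.range J) fun i => by
      simp +contextual
  calc reachSum M J m c ≤ ∑ i : Fin k, if (i : ℕ) < J then 1 else 0 :=
        Finset.sum_le_sum fun i _ => by split_ifs; exacts [win_le_one _ _, le_rfl]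
    _ = Finset.card {i ∈ Finset.range k | i < J} := by
        rw [Fin.sum_univ_eq_sum_range (fun i => if i < J then (1 : ℝ) else 0), Finset.sum_boole]
    _ ≤ J := by exact_mod_cast h

theorem le_reachSum {w : ℝ} (hJ : J ≤ k) (hw : w ≤ win M m) : J * w ≤ reachSum M J m c := by
  have h : {i ∈ Finset.range k | i < J} = Finset.range J := by
    ext i; simp only [Finset.mem_filter, Finset.mem_range]; omega
  calc J * w = ∑ i : Fin k, if (i : ℕ) < J then w else 0 := by
        rw [Fin.sum_univ_eq_sum_range (fun i => if i < J then w else 0), ← Finset.sum_filter, h]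
        simp
    _ ≤ reachSum M J m c := Finset.sum_le_sum fun i _ => by
        split_ifs; exacts [hw.trans (win_anti_left m (Nat.sub_le _ _)), le_rfl]

theorem reachSum_le_reachSum_snoc (a : ℕ) :
    reachSum M J m c ≤ reachSum M J m (Fin.snoc c a : Fin (k + 1) → ℕ) := by
  simp only [reachSum, Fin.sum_univ_castSucc, Fin.snoc_castSucc, Fin.snoc_last, Fin.val_castSucc]
  refine le_add_of_nonneg_right ?_
  split_ifs
  exacts [win_nonneg _ _, le_rfl]

theorem reachSum_update (i : Fin k) : reachSum M J m (Function.update c i (c i + 1)) =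
    reachSum M J m c + if (i : ℕ) < J then win (M - (c i + 1)) m - win (M - c i) m else 0 := by
  simp only [reachSum]
  rw [← Finset.add_sum_erase _ _ (Finset.mem_univ i),
    ← Finset.add_sum_erase _ (fun j : Fin k => if (j : ℕ) < J then win (M - c j) m else 0)
      (Finset.mem_univ i), Finset.sum_congr rfl fun j hj => by
        rw [Function.update_of_ne (Finset.ne_of_mem_erase hj)]]
  rw [Function.update_self]
  split_ifs <;> ring

theorem departMean_reachSum : departMean (reachSum M J m c)
    (fun i => reachSum M J (m + 1) (Function.update c i (c i + 1))) = reachSum M J (m + 1) c := by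
  have h : reachSum M J m c + ∑ i : Fin k, (if (i : ℕ) < J then
      win (M - (c i + 1)) (m + 1) - win (M - c i) (m + 1) else 0) = reachSum M J (m + 1) c := by
    simp only [reachSum, ← Finset.sum_add_distrib]
    refine Finset.sum_congr rfl fun i _ => ?_
    split_ifs <;> linarith [win_tsub_add_win_tsub M (c i) m]
  simp only [departMean, reachSum_update, Finset.sum_add_distrib, Finset.sum_const,
    Finset.card_univ, Fintype.card_fin, nsmul_eq_mul, smul_eq_mul]
  rw [inv_mul_eq_iff_eq_mul₀ (by positivity)]
  linarith

end ReachSum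

theorem prod_one_sub_le_one_sub_half_sum {ι : Type*} (s : Finset ι) (a : ι → ℝ)
    (h0 : ∀ i ∈ s, 0 ≤ a i) (h1 : ∑ i ∈ s, a i ≤ 1) :
    ∏ i ∈ s, (1 - a i) ≤ 1 - (∑ i ∈ s, a i) / 2 := by
  have hsum : 0 ≤ ∑ i ∈ s, a i := Finset.sum_nonneg h0
  calc ∏ i ∈ s, (1 - a i) ≤ ∏ i ∈ s, Real.exp (-a i) :=
        Finset.prod_le_prod (fun i hi => sub_nonneg.2 ((Finset.single_le_sum h0 hi).trans h1))
          fun i _ => Real.one_sub_le_exp_neg _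
    _ = (Real.exp (∑ i ∈ s, a i))⁻¹ := by
        rw [← Real.exp_sum, Finset.sum_neg_distrib, Real.exp_neg]
    _ ≤ 1 - (∑ i ∈ s, a i) / 2 := by
        rw [inv_le_iff_one_le_mul₀ (Real.exp_pos _)]
        nlinarith [Real.add_one_le_exp (∑ i ∈ s, a i)]

/-- The urn that counts the visits to each child, and pays `1 - δ` for each child visited at least
`M` times. -/
def countRule (M : ℕ) (δ : ℝ) : UrnRule ℕ where
  new := 0
  visit n := n + 1
  pay n := 1 - δ * win (M - n) 0

section CountRule

variable {p : unitInterval} {N M J : ℕ} {δ : ℝ}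

theorem countRule_pay_le_one (hδ0 : 0 ≤ δ) (n : ℕ) : (countRule M δ).pay n ≤ 1 :=
  sub_le_self _ (mul_nonneg hδ0 (win_nonneg _ _))

theorem countRule_pay_nonneg (hδ1 : δ ≤ 1) (n : ℕ) : 0 ≤ (countRule M δ).pay n :=
  sub_nonneg.2 (mul_le_one₀ hδ1 (win_nonneg _ _) (win_le_one _ _))

theorem countRule_pay_of_lt {n : ℕ} (h : n < M) : (countRule M δ).pay n = 1 := by
  obtain ⟨i, hi⟩ := Nat.exists_eq_add_one_of_ne_zero (Nat.sub_ne_zero_of_lt h)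
  simp [countRule, hi]

theorem countRule_pay_of_le {n : ℕ} (h : M ≤ n) : (countRule M δ).pay n = 1 - δ := by
  simp [countRule, Nat.sub_eq_zero_of_le h]

theorem prod_countRule_pay_le (hδ0 : 0 ≤ δ) (hδ1 : δ ≤ 1) (hδJ : δ * J ≤ 1) {k : ℕ}
    (c : Fin k → ℕ) : ∏ i, (countRule M δ).pay (c i) ≤ 1 - δ / 2 * reachSum M J 0 c := by
  have hsum : ∑ i : Fin k, δ * (if (i : ℕ) < J then win (M - c i) 0 else 0) =
      δ * reachSum M J 0 c := by rw [reachSum, Finset.mul_sum]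
  have hterm (i : Fin k) : 0 ≤ if (i : ℕ) < J then win (M - c i) 0 else 0 := by
    split_ifs; exacts [win_nonneg _ _, le_rfl]
  calc ∏ i, (countRule M δ).pay (c i)
      ≤ ∏ i : Fin k, (1 - δ * if (i : ℕ) < J then win (M - c i) 0 else 0) := by
        refine Finset.prod_le_prod (fun i _ => countRule_pay_nonneg hδ1 _) fun i _ => ?_
        split_ifs
        exacts [le_rfl, by simpa using countRule_pay_le_one hδ0 (c i)]
    _ ≤ 1 - δ * reachSum M J 0 c / 2 := by
        refine (prod_one_sub_le_one_sub_half_sum _ _ (fun i _ => mul_nonneg hδ0 (hterm i))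
          ?_).trans_eq (by rw [hsum])
        exact hsum.trans_le ((mul_le_mul_of_nonneg_left reachSum_le hδ0).trans hδJ)
    _ = 1 - δ / 2 * reachSum M J 0 c := by ring

theorem urn_countRule_le_reachSum (hδ0 : 0 ≤ δ) (hδ1 : δ ≤ 1) (hδJ : δ * J ≤ 1)
    (m n k : ℕ) (c : Fin k → ℕ) :
    urn p (countRule M δ) N m n k c ≤ 1 - δ / 2 * reachSum M J m c := by
  have h := urn_le_of_superharmonic (p := p) (rule := countRule M δ) (N := N) (m₀ := 0)
    (B := fun m _ c => 1 - δ / 2 * reachSum M J m c) (fun m k c => ?_) (fun n k c => ?_)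
    (fun m k c => ?_) m n k c
  · rwa [zero_add] at h
  · nlinarith [reachSum_le (M := M) (J := J) (m := m) (c := c),
      reachSum_nonneg (M := M) (J := J) (m := m) (c := c)]
  · rw [urn]
    exact prod_countRule_pay_le hδ0 hδ1 hδJ c
  · have depart (k : ℕ) (c : Fin k → ℕ) : departMean (1 - δ / 2 * reachSum M J m c)
        (fun i => 1 - δ / 2 * reachSum M J (m + 1) (Function.update c i (c i + 1))) =
        1 - δ / 2 * reachSum M J (m + 1) c := by
      rw [← departMean_reachSum]
      simp only [departMean, Finset.sum_sub_distrib, ← Finset.mul_sum, Finset.sum_const,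
        Finset.card_univ, Fintype.card_fin, nsmul_eq_mul, smul_eq_mul]
      field
    refine growMean_le (depart k c).le ((depart _ _).trans_le ?_)
    exact sub_le_sub_left (mul_le_mul_of_nonneg_left (reachSum_le_reachSum_snoc _)
      (by positivity)) _

/-- After `l` departures a new vertex has at least `16` children with high probability; each of
them then receives `M` visits with probability at least `1 / 4`. -/
theorem exists_urn_countRule_le {p₀ : ℝ} (hp0 : 0 < p₀) :
    ∃ (M : ℕ) (δ : ℝ), 0 < M ∧ 0 < δ ∧ δ ≤ 1 ∧ ∀ p : unitInterval, p₀ ≤ p → ∀ N n c,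
      urn p (countRule M δ) N M n 0 c ≤ 1 - δ := by
  obtain ⟨l, hl⟩ := exists_pow_lt_of_lt_one (show (0 : ℝ) < 1 / 2 ^ 17 by positivity)
    (show 1 - p₀ / 2 < 1 by linarith)
  have hl0 : l ≠ 0 := by rintro rfl; norm_num at hl
  obtain ⟨m₀, hm₀⟩ := exists_quarter_le_win l
  refine ⟨m₀ + l, 1 / 16, by omega, by norm_num, by norm_num, fun p hp N n c => ?_⟩
  have hbase (n k : ℕ) (c : Fin k → ℕ) : urn p (countRule (m₀ + l) (1 / 16)) N m₀ n k c ≤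
      1 - 1 / 8 * (1 - 2 ^ 16 * (1 / 2) ^ k) := by
    by_cases hk : 16 ≤ k
    · have hreach := urn_countRule_le_reachSum (p := p) (N := N) (M := m₀ + l) (J := 16)
        (δ := 1 / 16) (by norm_num) (by norm_num) (by norm_num) m₀ n k c
      have hsum := le_reachSum (c := c) hk hm₀
      have : (0 : ℝ) ≤ 2 ^ 16 * (1 / 2) ^ k := by positivity
      push_cast at hsum
      linarith
    · have hone := urn_le_one (p := p) (N := N)
        (countRule_pay_nonneg (M := m₀ + l) (δ := 1 / 16) (by norm_num))
        (countRule_pay_le_one (by norm_num)) m₀ n k c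
      have : ((1 : ℝ) / 2) ^ 16 ≤ (1 / 2) ^ k :=
        pow_le_pow_of_le_one (by norm_num) (by norm_num) (by omega)
      linarith
  have := urn_le_of_growth hp0.le hp (by norm_num) (by norm_num) (by positivity) hbase l n 0 c
  linarith

theorem urn_countRule_one_le (hδ0 : 0 ≤ δ) (hδ1 : δ ≤ 1) (n : ℕ) (c : Fin 0 → ℕ) :
    urn p (countRule M δ) N 1 n 0 c ≤ 1 - p * (δ * win M 1 / 4) := by
  have hwin : δ * win M 1 ≤ 1 := mul_le_one₀ hδ1 (win_nonneg _ _) (win_le_one _ _)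
  have hone (m n k : ℕ) (c : Fin k → ℕ) : urn p (countRule M δ) N m n k c ≤ 1 :=
    urn_le_one (countRule_pay_nonneg hδ1) (countRule_pay_le_one hδ0) m n k c
  cases n with
  | zero => rw [urn]; nlinarith [p.2.1, p.2.2, mul_nonneg hδ0 (win_nonneg M 1)]
  | succ n =>
    have stay : urnDepart p (countRule M δ) N 0 n 0 c ≤ 1 :=
      departMean_le (hone _ _ _ _) fun i => hone _ _ _ _
    have grow (c : Fin 1 → ℕ) :
        urnDepart p (countRule M δ) N 0 n 1 c ≤ 1 - δ * win M 1 / 4 := by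
      have visit := urn_countRule_le_reachSum (p := p) (N := N) (M := M) (J := 1) hδ0 hδ1
        (by simpa using hδ1) 1 n 1 (Function.update c 0 ((countRule M δ).visit (c 0)))
      have reach := le_reachSum (M := M) (m := 1) (J := 1)
        (c := Function.update c 0 ((countRule M δ).visit (c 0))) le_rfl le_rfl
      simp only [urnDepart, departMean, Finset.univ_unique, Fin.default_eq_zero,
        Finset.sum_singleton, smul_eq_mul, Nat.cast_one, one_mul] at reach ⊢
      linarith [hone 0 N 1 c, mul_le_mul_of_nonneg_left reach hδ0]
    rw [urn_succ_succ, growMean, smul_eq_mul, smul_eq_mul]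
    calc _ ≤ (1 - p) * 1 + p * (1 - δ * win M 1 / 4) :=
          add_le_add (mul_le_mul_of_nonneg_left stay (sub_nonneg.2 p.2.2))
            (mul_le_mul_of_nonneg_left (grow _) p.2.1)
      _ = 1 - p * (δ * win M 1 / 4) := by ring

end CountRule

/-! ### Excursions into abstract trees -/

/-- Rooted plane trees, given by the subtrees of the children of the root. -/
inductive Tree
  | node (k : ℕ) (c : Fin k → Tree) : Tree

/-- The tree with a single vertex. -/
def Tree.leaf : Tree := .node 0 Fin.elim0

/-- Given the law `R t` of the tree that results from an excursion into a child's subtree `t`, the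
law of the tree that results from an excursion that starts at the root and leaves it to its parent
within `n` departures. The mass missing from `1` is the probability of no such return. -/
def loop (p : unitInterval) (R : Tree → (Tree → ℝ) →ₗ[ℝ] ℝ) : ℕ → Tree → (Tree → ℝ) →ₗ[ℝ] ℝ
  | 0, _ => 0
  | n + 1, .node k c => growMean p Tree.leaf (fun k c => departMean (LinearMap.proj (.node k c))
      fun i => R (c i) ∘ₗ LinearMap.pi fun t => loop p R n (.node k (Function.update c i t))) k c

/-- The law of the tree that results from an excursion that stays below depth `h` and makes at most
`N` departures from a vertex between two arrivals from its parent. -/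
def excursion (p : unitInterval) (N : ℕ) : ℕ → Tree → (Tree → ℝ) →ₗ[ℝ] ℝ
  | 0 => fun _ => 0
  | h + 1 => loop p (excursion p N h) N

/-- The probability that `m` successive excursions all return. -/
def returns (R : Tree → (Tree → ℝ) →ₗ[ℝ] ℝ) : ℕ → Tree → ℝ
  | 0, _ => 1
  | m + 1, t => R t (returns R m)

section Excursion

variable {p : unitInterval} {R : Tree → (Tree → ℝ) →ₗ[ℝ] ℝ}

theorem isSubmean_loop (hR : ∀ t, IsSubmean (R t)) (n : ℕ) (t : Tree) :
    IsSubmean (loop p R n t) := by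
  induction n generalizing t with
  | zero => exact .zero
  | succ n ih =>
    obtain ⟨k, c⟩ := t
    have depart (k : ℕ) (c : Fin k → Tree) := departMean_mem (convex_isSubmean Tree)
      (IsSubmean.proj (.node k c)) fun i => (hR (c i)).bind fun t =>
        ih (.node k (Function.update c i t))
    exact growMean_mem (convex_isSubmean Tree) (depart _ _) (depart _ _)

theorem isSubmean_excursion (N h : ℕ) (t : Tree) : IsSubmean (excursion p N h t) := by
  induction h generalizing t with
  | zero => exact .zero
  | succ h ih => exact isSubmean_loop ih N t

theorem returns_nonneg (hR : ∀ t, IsSubmean (R t)) (m : ℕ) : 0 ≤ returns R m := by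
  induction m with
  | zero => exact fun _ => zero_le_one
  | succ m ih => exact fun t => (hR t).nonneg ih

theorem returns_anti (hR : ∀ t, IsSubmean (R t)) : Antitone (returns R) := by
  refine antitone_nat_of_succ_le fun m => ?_
  induction m with
  | zero => exact fun t => (hR t).map_one_le
  | succ m ih => exact fun t => (hR t).mono ih

/-- The urn in which the state of a child lists its payoffs after `0, 1, 2, …` further visits. -/
def listRule (f : ℕ → ℝ) : UrnRule (ℕ → ℝ) where
  new := f
  visit φ j := φ (j + 1)
  pay φ := φ 0

theorem map_urnDepart_listRule_update {α : Type*} (l : (α → ℝ) →ₗ[ℝ] ℝ) {f : ℕ → ℝ}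
    {N m n k : ℕ} (i : Fin k)
    (hexit : ∀ (φ : Fin k → ℕ → ℝ) (g : α → ℕ → ℝ),
      l (fun a => urn p (listRule f) N m N k (Function.update φ i (g a))) =
        urn p (listRule f) N m N k (Function.update φ i fun j => l fun a => g a j))
    (hvisit : ∀ (φ : Fin k → ℕ → ℝ) (g : α → ℕ → ℝ),
      l (fun a => urn p (listRule f) N (m + 1) n k (Function.update φ i (g a))) =
        urn p (listRule f) N (m + 1) n k (Function.update φ i fun j => l fun a => g a j))
    (φ : Fin k → ℕ → ℝ) (g : α → ℕ → ℝ) :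
    l (fun a => urnDepart p (listRule f) N m n k (Function.update φ i (g a))) =
      urnDepart p (listRule f) N m n k (Function.update φ i fun j => l fun a => g a j) := by
  simp only [urnDepart]
  rw [← hexit]
  refine (congrArg l (funext fun a => (departMean_apply _ _ a).symm)).trans
    ((map_departMean l _ _).trans ?_)
  congr 1
  funext r
  rcases eq_or_ne r i with rfl | hr
  · simp only [Function.update_self, Function.update_idem]
    exact hvisit φ fun a j => g a (j + 1)
  · simp only [Function.update_of_ne hr, Function.update_comm hr.symm]
    exact hvisit _ g

/-- The urn is multilinear in the states of the children. -/
theorem map_urn_listRule_update {α : Type*} (l : (α → ℝ) →ₗ[ℝ] ℝ) {f : ℕ → ℝ} {N : ℕ}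
    (m n : ℕ) {k : ℕ} (i : Fin k) (φ : Fin k → ℕ → ℝ) (g : α → ℕ → ℝ) :
    l (fun a => urn p (listRule f) N m n k (Function.update φ i (g a))) =
      urn p (listRule f) N m n k (Function.update φ i fun j => l fun a => g a j) := by
  induction m generalizing n k g with
  | zero =>
    have h (x : ℕ → ℝ) : urn p (listRule f) N 0 n k (Function.update φ i x) =
        (∏ r ∈ Finset.univ.erase i, φ r 0) * x 0 := by
      rw [urn, ← Finset.prod_erase_mul _ _ (Finset.mem_univ i), Function.update_self]
      congr 1
      refine Finset.prod_congr rfl fun r hr => ?_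
      rw [Function.update_of_ne (Finset.ne_of_mem_erase hr)]
      rfl
    simp only [h]
    exact l.map_smul _ _
  | succ m ihm =>
    induction n generalizing k g with
    | zero =>
      simp only [urn]
      exact map_zero l
    | succ n ihn =>
      have depart {k : ℕ} (i : Fin k) (φ : Fin k → ℕ → ℝ) :=
        map_urnDepart_listRule_update (p := p) (f := f) (N := N) l i
          (fun φ => ihm N i φ) (fun φ => ihn i φ) φ g
      simp only [urn_succ_succ, growMean, Fin.snoc_update]
      rw [← depart, ← depart, ← map_smul, ← map_smul, ← map_add]
      rfl

/-- Given the numbers of visits, excursions into different subtrees are independent. -/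
theorem loop_eq_urn {N m : ℕ} {κ : Tree → ℝ} (hκ : ∀ k (c : Fin k → Tree), κ (.node k c) =
      urn p (listRule fun j => returns R j Tree.leaf) N m N k fun i j => returns R j (c i))
    (n k : ℕ) (c : Fin k → Tree) : loop p R n (.node k c) κ =
      urn p (listRule fun j => returns R j Tree.leaf) N (m + 1) n k
        fun i j => returns R j (c i) := by
  induction n generalizing k c with
  | zero => rw [urn]; rfl
  | succ n ihn =>
    have depart (k : ℕ) (c : Fin k → Tree) : departMean (LinearMap.proj (.node k c))
        (fun i => R (c i) ∘ₗ LinearMap.pi fun t => loop p R n (.node k (Function.update c i t))) κ =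
        urnDepart p (listRule fun j => returns R j Tree.leaf) N m n k
          fun i j => returns R j (c i) := by
      rw [departMean_linearMap_apply, urnDepart, ← hκ]
      congr 1
      funext i
      refine .trans ?_ (map_urn_listRule_update (R (c i)) _ _ _ _ fun t j => returns R j t)
      refine congrArg (R (c i)) (funext fun t => (ihn k _).trans ?_)
      congr 1
      exact funext (Function.apply_update (fun _ t j => returns R j t) c i t)
    rw [urn_succ_succ, loop, growMean_linearMap_apply]
    simp only [growMean, depart]
    congr 3
    exact Fin.comp_snoc (fun t j => returns R j t) c Tree.leaf

theorem returns_loop (N m k : ℕ) (c : Fin k → Tree) : returns (loop p R N) m (.node k c) =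
    urn p (listRule fun j => returns R j Tree.leaf) N m N k fun i j => returns R j (c i) := by
  induction m generalizing k c with
  | zero => simp [returns, urn, listRule]
  | succ m ihm => exact loop_eq_urn ihm N k c

theorem urn_listRule_le_urn_countRule {f : ℕ → ℝ} {M N k : ℕ} {δ : ℝ} {φ : Fin k → ℕ → ℝ}
    {c : Fin k → ℕ} (hf : ∀ j, 0 ≤ f j ∧ f j ≤ (countRule M δ).pay j)
    (hφ : ∀ i j, 0 ≤ φ i j ∧ φ i j ≤ (countRule M δ).pay (c i + j)) (m n : ℕ) :
    urn p (listRule f) N m n k φ ≤ urn p (countRule M δ) N m n k c := by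
  refine urn_le_urn (fun φ ν => ∀ j, 0 ≤ φ j ∧ φ j ≤ (countRule M δ).pay (ν + j))
    (fun j => ⟨(hf j).1, ?_⟩) (fun φ ν h j => ⟨(h _).1, ?_⟩) (fun φ ν h => h 0) m n hφ
  · exact (hf j).2.trans_eq (by rw [countRule, Nat.zero_add])
  · exact (h (j + 1)).2.trans_eq (by simp only [countRule, add_assoc, add_comm 1])

theorem returns_excursion_succ_leaf_le {M N h : ℕ} {δ : ℝ}
    (hpay : ∀ j, returns (excursion p N h) j Tree.leaf ≤ (countRule M δ).pay j) (m : ℕ)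
    (c : Fin 0 → ℕ) :
    returns (excursion p N (h + 1)) m Tree.leaf ≤ urn p (countRule M δ) N m N 0 c := by
  rw [excursion, Tree.leaf, returns_loop]
  exact urn_listRule_le_urn_countRule
    (fun j => ⟨returns_nonneg (isSubmean_excursion N h) j _, hpay j⟩) (fun i => i.elim0) m N

/-- If `M` excursions from each new child return with probability at most `1 - δ`, then so do `M`
excursions from a new vertex, by the choice of `M` and `δ`. -/
theorem returns_excursion_leaf_le {M N : ℕ} {δ : ℝ} (hM : 0 < M) (hδ1 : δ ≤ 1)
    (hurn : ∀ c, urn p (countRule M δ) N M N 0 c ≤ 1 - δ) (h j : ℕ) :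
    returns (excursion p N h) j Tree.leaf ≤ (countRule M δ).pay j := by
  induction h generalizing j with
  | zero =>
    rcases j with _ | j
    · exact (countRule_pay_of_lt hM).ge
    · exact countRule_pay_nonneg hδ1 _
  | succ h ih =>
    have hanti := returns_anti (isSubmean_excursion (p := p) N (h + 1))
    rcases lt_or_ge j M with hj | hj
    · rw [countRule_pay_of_lt hj]
      exact hanti (Nat.zero_le j) _
    · rw [countRule_pay_of_le hj]
      exact (hanti hj _).trans ((returns_excursion_succ_leaf_le ih M Fin.elim0).trans (hurn _))

theorem exists_excursion_leaf_le {p₀ : ℝ} (hp0 : 0 < p₀) :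
    ∃ q < 1, ∀ p : unitInterval, p₀ ≤ p → ∀ N h, excursion p N h Tree.leaf 1 ≤ q := by
  obtain ⟨M, δ, hM, hδ0, hδ1, hurn⟩ := exists_urn_countRule_le hp0
  have hwin := mul_pos hδ0 (win_one_right_pos M)
  have hwin1 : δ * win M 1 ≤ 1 := mul_le_one₀ hδ1 (win_nonneg _ _) (win_le_one _ _)
  refine ⟨1 - p₀ * (δ * win M 1 / 4), sub_lt_self _ (by positivity), fun p hp N h => ?_⟩
  have hle : p₀ * (δ * win M 1 / 4) ≤ p * (δ * win M 1 / 4) := by gcongr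
  cases h with
  | zero => exact sub_nonneg.2 (hle.trans (mul_le_one₀ p.2.2 (by positivity) (by linarith)))
  | succ h =>
    calc excursion p N (h + 1) Tree.leaf 1
        ≤ urn p (countRule M δ) N 1 N 0 Fin.elim0 := returns_excursion_succ_leaf_le
          (returns_excursion_leaf_le hM hδ1 (hurn p hp N N) h) 1 _
      _ ≤ 1 - p * (δ * win M 1 / 4) := urn_countRule_one_le hδ0.le hδ1 _ _
      _ ≤ 1 - p₀ * (δ * win M 1 / 4) := sub_le_sub_left hle 1

end Excursion

/-! ### One step of the walk -/

namespace State

variable (s : State)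

theorem fresh_ne {v : ℕ} (hv : v ∈ s.tree.verts) : v ≠ s.fresh := fun h => s.fresh_notMem (h ▸ hv)

@[simp] theorem grow_pos : s.grow.pos = s.pos := rfl

theorem grow_adj (a b : ℕ) : s.grow.tree.Adj a b ↔
    s.tree.Adj a b ∨ (a = s.pos ∧ b = s.fresh) ∨ (a = s.fresh ∧ b = s.pos) := by
  change s.grownTree.Adj a b ↔ _
  simp only [grownTree, SimpleGraph.Subgraph.sup_adj, SimpleGraph.subgraphOfAdj_adj, Sym2.eq_iff]
  grind

theorem mem_grow_verts (a : ℕ) : a ∈ s.grow.tree.verts ↔ a ∈ s.tree.verts ∨ a = s.fresh := by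
  change a ∈ s.grownTree.verts ↔ _
  simp only [grownTree, SimpleGraph.Subgraph.verts_sup, SimpleGraph.subgraphOfAdj_verts,
    Set.mem_union, Set.mem_insert_iff, Set.mem_singleton_iff]
  have := s.pos_mem
  grind

theorem le_grow : s.tree ≤ s.grow.tree := le_sup_left

/-- The neighbours of the walker's position. -/
def nb : Finset ℕ := (s.finite_neighborSet s.pos).toFinset

@[simp] theorem mem_nb (v : ℕ) : v ∈ s.nb ↔ s.tree.Adj s.pos v := by simp [nb]

theorem nb_grow : s.grow.nb = insert s.fresh s.nb := by
  ext v
  have := s.pos_ne_fresh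
  simp only [mem_nb, grow_adj, grow_pos, Finset.mem_insert]
  grind

theorem fresh_notMem_nb : s.fresh ∉ s.nb := fun h =>
  s.fresh_notMem ((s.mem_nb _).1 h).snd_mem

open Classical in
/-- The state after the walker moves to `v`. If `v` is not a neighbour of its position, then the
walker stays put. -/
def goto (v : ℕ) : State := if h : s.tree.Adj s.pos v then s.moveTo ⟨v, h⟩ else s

@[simp] theorem goto_tree (v : ℕ) : (s.goto v).tree = s.tree := by
  unfold goto; split <;> rfl

theorem goto_pos {v : ℕ} (h : s.tree.Adj s.pos v) : (s.goto v).pos = v := by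
  rw [goto, dif_pos h]; rfl

theorem goto_of_not_adj {v : ℕ} (h : ¬ s.tree.Adj s.pos v) : s.goto v = s := dif_neg h

theorem goto_self : s.goto s.pos = s := s.goto_of_not_adj fun h => h.ne rfl

open Classical in
/-- The mean value of a function of the state after the walker jumps. -/
def jumpAvg : (State → ℝ) →ₗ[ℝ] ℝ :=
  if s.nb.Nonempty then (s.nb.card : ℝ)⁻¹ • ∑ v ∈ s.nb, LinearMap.proj (s.goto v)
  else LinearMap.proj s

/-- The mean value of a function of the state after one step of the walk. -/
def stepAvg (p : unitInterval) : (State → ℝ) →ₗ[ℝ] ℝ :=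
  (p : ℝ) • s.grow.jumpAvg + (1 - p : ℝ) • s.jumpAvg

/-- The state `t` can follow `s` in the walk, possibly after growing a leaf. -/
def Steps (t : State) : Prop := ∃ v, t = s.goto v ∨ t = s.grow.goto v

theorem Steps.le {s t : State} (h : s.Steps t) : s.tree ≤ t.tree := by
  obtain ⟨v, rfl | rfl⟩ := h
  · exact (s.goto_tree v).ge
  · exact (s.grow.goto_tree v).symm ▸ s.le_grow

theorem jumpAvg_of_nonempty (h : s.nb.Nonempty) (g : State → ℝ) :
    s.jumpAvg g = (s.nb.card : ℝ)⁻¹ * ∑ v ∈ s.nb, g (s.goto v) := by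
  simp [jumpAvg, if_pos h]

theorem jumpAvg_of_not_nonempty (h : ¬ s.nb.Nonempty) (g : State → ℝ) : s.jumpAvg g = g s := by
  simp [jumpAvg, if_neg h]

theorem jumpAvg_mono {g h : State → ℝ} (H : ∀ v, g (s.goto v) ≤ h (s.goto v)) :
    s.jumpAvg g ≤ s.jumpAvg h := by
  by_cases hs : s.nb.Nonempty
  · rw [jumpAvg_of_nonempty s hs, jumpAvg_of_nonempty s hs]
    gcongr with v
    exact H v
  · rw [jumpAvg_of_not_nonempty s hs, jumpAvg_of_not_nonempty s hs]
    exact s.goto_self ▸ H s.pos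

theorem jumpAvg_one : s.jumpAvg 1 = 1 := by
  by_cases hs : s.nb.Nonempty
  · have : (s.nb.card : ℝ) ≠ 0 := by exact_mod_cast (Finset.card_pos.2 hs).ne'
    simp [jumpAvg_of_nonempty s hs, this]
  · simp [jumpAvg_of_not_nonempty s hs]

theorem jumpAvg_nonneg {g : State → ℝ} (hg : 0 ≤ g) : 0 ≤ s.jumpAvg g :=
  map_zero s.jumpAvg ▸ s.jumpAvg_mono fun _ => hg _

theorem stepAvg_apply (p : unitInterval) (g : State → ℝ) :
    s.stepAvg p g = p * s.grow.jumpAvg g + (1 - p) * s.jumpAvg g := rfl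

variable {p : unitInterval}

theorem stepAvg_mono {g h : State → ℝ} (H : ∀ t, s.Steps t → g t ≤ h t) :
    s.stepAvg p g ≤ s.stepAvg p h :=
  add_le_add
    (mul_le_mul_of_nonneg_left (s.grow.jumpAvg_mono fun v => H _ ⟨v, .inr rfl⟩) p.2.1)
    (mul_le_mul_of_nonneg_left (s.jumpAvg_mono fun v => H _ ⟨v, .inl rfl⟩) (sub_nonneg.2 p.2.2))

theorem stepAvg_one : s.stepAvg p 1 = 1 := by
  simp [stepAvg_apply, jumpAvg_one]

theorem isSubmean_stepAvg : IsSubmean (s.stepAvg p) :=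
  ⟨fun _ _ h => s.stepAvg_mono fun t _ => h t, s.stepAvg_one.le⟩

theorem lintegral_jump {g : State → ℝ} (hg : 0 ≤ g) :
    ∫⁻ t, ENNReal.ofReal (g t) ∂s.jump.toMeasure = ENNReal.ofReal (s.jumpAvg g) := by
  classical
  by_cases hne : (s.tree.neighborSet s.pos).Nonempty
  · have := hne.to_subtype
    have := (s.finite_neighborSet s.pos).fintype
    let _ : MeasurableSpace (s.tree.neighborSet s.pos) := ⊤
    have hjump : s.jump = (PMF.uniformOfFintype (s.tree.neighborSet s.pos)).map s.moveTo := by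
      rw [jump, dif_pos hne]; congr!
    have hnb : s.nb.Nonempty := by simpa [nb] using hne
    have hcard : s.nb.card = Fintype.card (s.tree.neighborSet s.pos) := by
      rw [nb, Set.Finite.card_toFinset]
    have hpos : (0 : ℝ) < s.nb.card := by exact_mod_cast Finset.card_pos.2 hnb
    have hterm (v : s.tree.neighborSet s.pos) : ENNReal.ofReal (g (s.moveTo v)) *
        (PMF.uniformOfFintype (s.tree.neighborSet s.pos)).toMeasure {v} =
        ENNReal.ofReal ((s.nb.card : ℝ)⁻¹ * g (s.goto v)) := by
      have hv : s.goto v = s.moveTo v := dif_pos v.2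
      rw [hv, PMF.toMeasure_apply_singleton _ _ (MeasurableSet.singleton v),
        PMF.uniformOfFintype_apply, ← hcard, ENNReal.ofReal_mul (inv_nonneg.2 hpos.le),
        ENNReal.ofReal_inv_of_pos hpos, ENNReal.ofReal_natCast, mul_comm]
    rw [hjump, ← PMF.toMeasure_map (hf := measurable_from_top),
      lintegral_map measurable_from_top measurable_from_top, lintegral_fintype,
      jumpAvg_of_nonempty s hnb, Finset.sum_congr rfl fun v _ => hterm v, Finset.mul_sum,
      ← ENNReal.ofReal_sum_of_nonneg fun v _ => mul_nonneg (inv_nonneg.2 hpos.le) (hg _)]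
    congr 1
    exact (Finset.sum_subtype s.nb (by simp) fun v => (s.nb.card : ℝ)⁻¹ * g (s.goto v)).symm
  · have hnb : ¬ s.nb.Nonempty := by simpa [nb] using hne
    rw [jump, dif_neg hne, jumpAvg_of_not_nonempty s hnb, PMF.toMeasure_pure, lintegral_dirac]

end State

theorem lintegral_step (p : unitInterval) (s : State) {g : State → ℝ} (hg : 0 ≤ g) :
    ∫⁻ t, ENNReal.ofReal (g t) ∂step p s = ENNReal.ofReal (s.stepAvg p g) := by
  have hp : 0 ≤ 1 - (p : ℝ) := sub_nonneg.2 p.2.2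
  rw [step, lintegral_add_measure, lintegral_smul_measure, lintegral_smul_measure,
    State.lintegral_jump _ hg, State.lintegral_jump _ hg, smul_eq_mul, smul_eq_mul,
    ← ENNReal.ofReal_mul p.2.1, ← ENNReal.ofReal_mul hp,
    ← ENNReal.ofReal_add (mul_nonneg p.2.1 (s.grow.jumpAvg_nonneg hg))
      (mul_nonneg hp (s.jumpAvg_nonneg hg)), State.stepAvg_apply]

/-! ### Hitting a vertex -/

/-- The mean value of a function of the state at the first visit to `y`, on the event that this
visit happens within `n` steps. -/
def hit (p : unitInterval) (y : ℕ) : ℕ → State → (State → ℝ) →ₗ[ℝ] ℝ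
  | 0, s => if s.pos = y then LinearMap.proj s else 0
  | n + 1, s => if s.pos = y then LinearMap.proj s else s.stepAvg p ∘ₗ LinearMap.pi (hit p y n)

section Hit

variable {p : unitInterval} {y v : ℕ} {g g' : State → ℝ}

theorem hit_of_pos_eq {s : State} (h : s.pos = y) (n : ℕ) (g : State → ℝ) :
    hit p y n s g = g s := by
  cases n <;> simp [hit, h]

theorem hit_zero_of_pos_ne {s : State} (h : s.pos ≠ y) (g : State → ℝ) : hit p y 0 s g = 0 := by
  rw [hit, if_neg h, LinearMap.zero_apply]

theorem hit_succ_of_pos_ne {s : State} (h : s.pos ≠ y) (n : ℕ) (g : State → ℝ) :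
    hit p y (n + 1) s g = s.stepAvg p fun t => hit p y n t g := by
  rw [hit, if_neg h]
  rfl

theorem isSubmean_hit (n : ℕ) (s : State) : IsSubmean (hit p y n s) := by
  induction n generalizing s with
  | zero =>
    rw [hit]
    split_ifs
    exacts [.proj s, .zero]
  | succ n ih =>
    rw [hit]
    split_ifs
    exacts [.proj s, s.isSubmean_stepAvg.bind ih]

theorem hit_mono_time (hg : 0 ≤ g) (s : State) : Monotone fun n => hit p y n s g := by
  refine monotone_nat_of_le_succ fun n => ?_
  induction n generalizing s with
  | zero =>
    by_cases hs : s.pos = y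
    · simp only [hit_of_pos_eq hs, le_refl]
    · exact (hit_zero_of_pos_ne hs g).trans_le ((isSubmean_hit 1 s).nonneg hg)
  | succ n ih =>
    by_cases hs : s.pos = y
    · simp only [hit_of_pos_eq hs, le_refl]
    · rw [hit_succ_of_pos_ne hs, hit_succ_of_pos_ne hs]
      exact s.stepAvg_mono fun t _ => ih t

theorem hit_mono (n : ℕ) (s : State)
    (h : ∀ t : State, t.pos = y → s.tree ≤ t.tree → g t ≤ g' t) :
    hit p y n s g ≤ hit p y n s g' := by
  induction n generalizing s with
  | zero =>
    by_cases hs : s.pos = y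
    · simpa only [hit_of_pos_eq hs] using h s hs le_rfl
    · rw [hit_zero_of_pos_ne hs, hit_zero_of_pos_ne hs]
  | succ n ih =>
    by_cases hs : s.pos = y
    · simpa only [hit_of_pos_eq hs] using h s hs le_rfl
    · rw [hit_succ_of_pos_ne hs, hit_succ_of_pos_ne hs]
      exact s.stepAvg_mono fun t ht => ih t fun u hu hu' => h u hu (ht.le.trans hu')

theorem hit_le (n : ℕ) (s : State) {b : ℝ}
    (h : ∀ t : State, t.pos = y → s.tree ≤ t.tree → g t ≤ b) :
    hit p y n s g ≤ b * hit p y n s 1 :=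
  calc hit p y n s g ≤ hit p y n s (b • 1) := hit_mono n s fun t ht hst => by simpa using h t ht hst
    _ = b * hit p y n s 1 := map_smul _ _ _

end Hit

/-! ### Branches -/

/-- A set `L` of vertices of `T` that can only be left through the vertex `v ∉ L`. -/
structure IsBranch (T : (⊤ : SimpleGraph ℕ).Subgraph) (L : Set ℕ) (v : ℕ) : Prop where
  subset : L ⊆ T.verts
  notMem : v ∉ L
  mem_or_eq_of_adj : ∀ u ∈ L, ∀ w, T.Adj u w → w ∈ L ∨ w = v

namespace IsBranch

variable {s : State} {L : Set ℕ} {v : ℕ}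

theorem grow (h : IsBranch s.tree L v) (hv : v ∈ s.tree.verts) (hs : s.pos ∈ L) :
    IsBranch s.grow.tree (insert s.fresh L) v where
  subset := by
    rintro u (rfl | hu)
    · exact (s.mem_grow_verts _).2 (.inr rfl)
    · exact (s.mem_grow_verts _).2 (.inl (h.subset hu))
  notMem := by
    rintro (hv' | hv')
    · exact s.fresh_ne hv hv'
    · exact h.notMem hv'
  mem_or_eq_of_adj u hu w huw := by
    rw [State.grow_adj] at huw
    rcases huw with huw | ⟨-, rfl⟩ | ⟨-, rfl⟩
    · rcases hu with rfl | hu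
      · exact absurd huw.fst_mem s.fresh_notMem
      · exact (h.mem_or_eq_of_adj u hu w huw).imp_left .inr
    · exact .inl (.inl rfl)
    · exact .inl (.inr hs)

theorem goto_pos_mem_or_eq (h : IsBranch s.tree L v) (hs : s.pos ∈ L) (w : ℕ) :
    (s.goto w).pos ∈ L ∨ (s.goto w).pos = v := by
  by_cases hw : s.tree.Adj s.pos w
  · rw [s.goto_pos hw]
    exact h.mem_or_eq_of_adj _ hs w hw
  · rw [s.goto_of_not_adj hw]
    exact .inl hs

theorem step {t : State} {y : ℕ} (h : IsBranch s.tree L v) (hv : v ∈ s.tree.verts) (hs : s.pos ∈ L)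
    (hy : y ∈ s.tree.verts) (hyL : y ∉ L) (ht : s.Steps t) :
    t.pos = v ∨ ∃ L', IsBranch t.tree L' v ∧ t.pos ∈ L' ∧ y ∉ L' := by
  obtain ⟨w, rfl | rfl⟩ := ht
  · refine (h.goto_pos_mem_or_eq hs w).symm.imp_right fun hw => ⟨L, ?_, hw, hyL⟩
    rwa [State.goto_tree]
  · have hgrow := h.grow hv hs
    refine (hgrow.goto_pos_mem_or_eq (.inr hs) w).symm.imp_right fun hw => ⟨_, ?_, hw, ?_⟩
    · rwa [State.goto_tree]
    · rintro (hy' | hy')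
      exacts [s.fresh_ne hy hy', hyL hy']

/-- The strong Markov property at the first visit to `v`. -/
theorem hit_le_hit {p : unitInterval} {y : ℕ} {g : State → ℝ} (hg : 0 ≤ g) {n N : ℕ} (hn : n ≤ N)
    (h : IsBranch s.tree L v) (hs : s.pos ∈ L) (hv : v ∈ s.tree.verts) (hy : y ∈ s.tree.verts)
    (hyL : y ∉ L) : hit p y n s g ≤ hit p v n s fun t => hit p y N t g := by
  have hsy : s.pos ≠ y := by rintro rfl; exact hyL hs
  have hsv : s.pos ≠ v := by rintro rfl; exact h.notMem hs
  induction n generalizing s L with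
  | zero => rw [hit_zero_of_pos_ne hsy, hit_zero_of_pos_ne hsv]
  | succ n ih =>
    rw [hit_succ_of_pos_ne hsy, hit_succ_of_pos_ne hsv]
    refine s.stepAvg_mono fun t ht => ?_
    rcases h.step hv hs hy hyL ht with htv | ⟨L', hL', htL', hyL'⟩
    · rw [hit_of_pos_eq htv]
      exact hit_mono_time hg t (by omega)
    · refine ih (by omega) hL' htL' (ht.le.1 hv) (ht.le.1 hy) hyL' ?_ ?_
      · rintro rfl; exact hyL' htL'
      · rintro rfl; exact hL'.notMem htL'

end IsBranch

theorem State.exists_isBranch (s : State) {w v : ℕ} (h : s.tree.Adj w v) :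
    ∃ L, IsBranch s.tree L v ∧ w ∈ L ∧
      ∀ y, (s.tree.spanningCoe.deleteEdges {s(w, v)}).Reachable v y → y ∉ L := by
  set G := s.tree.spanningCoe.deleteEdges {s(w, v)} with hG
  have hbridge : ¬ G.Reachable w v := SimpleGraph.isBridge_iff.1
    (SimpleGraph.isAcyclic_iff_forall_adj_isBridge.1 s.acyclic
      (show s.tree.spanningCoe.Adj w v from h))
  refine ⟨{u | G.Reachable w u}, ⟨fun u hu => ?_, hbridge, fun u hu z hz => ?_⟩, .refl _,
    fun y hy hy' => hbridge (hy'.trans hy.symm)⟩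
  · obtain ⟨q⟩ := (hu : G.Reachable w u)
    rcases eq_or_ne w u with rfl | hne
    · exact h.fst_mem
    · have := q.reverse.adj_snd (SimpleGraph.Walk.not_nil_of_ne hne.symm)
      exact s.tree.edge_vert (SimpleGraph.deleteEdges_adj.1 this).1
  · by_cases he : s(u, z) = s(w, v)
    · rcases Sym2.eq_iff.1 he with ⟨-, rfl⟩ | ⟨rfl, -⟩
      · exact .inr rfl
      · exact absurd hu hbridge
    · refine .inl (SimpleGraph.Reachable.trans hu (SimpleGraph.Adj.reachable ?_))
      rw [hG, SimpleGraph.deleteEdges_adj]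
      exact ⟨hz, he⟩

/-! ### Comparison of the walk with the excursions into abstract trees -/

/-- The neighbours of `z` in `T` are a parent `x` and children `v i`, and the sets `B i` are
candidates for the branches of `T` at the children. -/
structure Junction (T : (⊤ : SimpleGraph ℕ).Subgraph) (x z : ℕ) {k : ℕ} (v : Fin k → ℕ)
    (B : Fin k → Set ℕ) : Prop where
  adj_iff : ∀ w, T.Adj z w ↔ w = x ∨ ∃ i, v i = w
  notMem : ∀ i, z ∉ B i
  disjoint : Pairwise fun i j => Disjoint (B i) (B j)

/-- In the graph `T`, the set `L` of the vertices that lie beyond `z`, as seen from its neighbour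
`x`, carries the shape of a rooted tree. -/
inductive HasShape (T : (⊤ : SimpleGraph ℕ).Subgraph) : Tree → ℕ → ℕ → Set ℕ → Prop
  | node {k : ℕ} {c : Fin k → Tree} {x z : ℕ} {v : Fin k → ℕ} {B : Fin k → Set ℕ}
      (junction : Junction T x z v B) (child : ∀ i, HasShape T (c i) z (v i) (B i)) :
      HasShape T (.node k c) x z (insert z (⋃ i, B i))

/-- The graph `T'` arises from `T` by adding vertices and edges to the set `L`, which becomes
`L'`. -/
structure LocalChange (T : (⊤ : SimpleGraph ℕ).Subgraph) (L : Set ℕ)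
    (T' : (⊤ : SimpleGraph ℕ).Subgraph) (L' : Set ℕ) : Prop where
  le : T ≤ T'
  adj_iff : ∀ u ∈ T.verts, u ∉ L → ∀ w, T'.Adj u w ↔ T.Adj u w
  mem_iff : ∀ u ∈ T.verts, u ∈ L' ↔ u ∈ L

namespace LocalChange

variable {T T' T'' : (⊤ : SimpleGraph ℕ).Subgraph} {L L' L'' : Set ℕ}

theorem refl (T : (⊤ : SimpleGraph ℕ).Subgraph) (L : Set ℕ) : LocalChange T L T L :=
  ⟨le_rfl, fun _ _ _ _ => .rfl, fun _ _ => .rfl⟩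

theorem trans (h : LocalChange T L T' L') (h' : LocalChange T' L' T'' L'') :
    LocalChange T L T'' L'' where
  le := h.le.trans h'.le
  adj_iff u hu huL w := by
    rw [h'.adj_iff u (h.le.1 hu) (by rwa [h.mem_iff u hu]), h.adj_iff u hu huL]
  mem_iff u hu := by rw [h'.mem_iff u (h.le.1 hu), h.mem_iff u hu]

theorem insert_iUnion {k : ℕ} {B : Fin k → Set ℕ} {i : Fin k} (h : LocalChange T (B i) T' L')
    (z : ℕ) : LocalChange T (insert z (⋃ j, B j)) T'
      (insert z (⋃ j, (Function.update B i L' j))) where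
  le := h.le
  adj_iff u hu huL := h.adj_iff u hu fun hui => huL (.inr (Set.mem_iUnion_of_mem i hui))
  mem_iff u hu := by
    have hmem (j : Fin k) : u ∈ Function.update B i L' j ↔ u ∈ B j := by
      rcases eq_or_ne j i with rfl | hj
      · rw [Function.update_self, h.mem_iff u hu]
      · rw [Function.update_of_ne hj]
    simp only [Set.mem_insert_iff, Set.mem_iUnion, hmem]

theorem grow {s : State} {L : Set ℕ} (hs : s.pos ∈ L) :
    LocalChange s.tree L s.grow.tree (insert s.fresh L) where
  le := s.le_grow
  adj_iff u hu huL w := by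
    rw [State.grow_adj]
    have hpos : u ≠ s.pos := by rintro rfl; exact huL hs
    have hfresh := s.fresh_ne hu
    tauto
  mem_iff u hu := by simp [s.fresh_ne hu]

end LocalChange

namespace HasShape

variable {T T' : (⊤ : SimpleGraph ℕ).Subgraph} {t : Tree} {x z : ℕ} {L : Set ℕ}

theorem root_mem (h : HasShape T t x z L) : z ∈ L := by
  cases h
  exact Set.mem_insert z _

theorem adj_parent (h : HasShape T t x z L) : T.Adj z x := by
  obtain ⟨J, -⟩ := h
  exact (J.adj_iff x).2 (.inl rfl)

theorem subset (h : HasShape T t x z L) : L ⊆ T.verts := by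
  induction h with
  | node J _ ih =>
    exact Set.insert_subset ((J.adj_iff _).2 (.inl rfl)).fst_mem (Set.iUnion_subset ih)

theorem congr (h : HasShape T t x z L) (hT : ∀ u ∈ L, ∀ w, T'.Adj u w ↔ T.Adj u w) :
    HasShape T' t x z L := by
  induction h with
  | node J _ ih =>
    refine .node ⟨fun w => ?_, J.notMem, J.disjoint⟩ fun i => ih i fun u hu => ?_
    · rw [hT _ (Set.mem_insert _ _), J.adj_iff]
    · exact hT u (.inr (Set.mem_iUnion_of_mem i hu))

theorem mem_or_eq_of_adj (h : HasShape T t x z L) {u w : ℕ} (hu : u ∈ L) (hw : T.Adj u w) :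
    w ∈ L ∨ w = x := by
  induction h with
  | node J hc ih =>
    rcases hu with rfl | hu
    · rcases (J.adj_iff w).1 hw with rfl | ⟨i, rfl⟩
      · exact .inr rfl
      · exact .inl (.inr (Set.mem_iUnion_of_mem i (hc i).root_mem))
    · obtain ⟨i, hi⟩ := Set.mem_iUnion.1 hu
      rcases ih i hi with hwi | rfl
      · exact .inl (.inr (Set.mem_iUnion_of_mem i hwi))
      · exact .inl (Set.mem_insert _ _)

theorem isBranch (h : HasShape T t x z L) (hx : x ∉ L) : IsBranch T L x :=
  ⟨h.subset, hx, fun _ hu _ hw => h.mem_or_eq_of_adj hu hw⟩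

theorem leaf (h : ∀ w, T.Adj z w ↔ w = x) : HasShape T Tree.leaf x z {z} := by
  have hL : ({z} : Set ℕ) = insert z (⋃ i : Fin 0, Fin.elim0 i) := by simp
  rw [hL]
  exact .node (v := Fin.elim0) ⟨fun w => by simp [h], (·.elim0), fun i => i.elim0⟩ (·.elim0)

theorem fresh (s : State) : HasShape s.grow.tree Tree.leaf s.pos s.fresh {s.fresh} := by
  refine leaf fun w => ?_
  have hadj : ¬ s.tree.Adj s.fresh w := fun h => s.fresh_notMem h.fst_mem
  simp [State.grow_adj, hadj, s.pos_ne_fresh.symm]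

end HasShape

namespace Junction

variable {T T' : (⊤ : SimpleGraph ℕ).Subgraph} {x z k : ℕ} {v : Fin k → ℕ} {B : Fin k → Set ℕ}
  {c : Fin k → Tree}

theorem injective (J : Junction T x z v B) (hc : ∀ i, HasShape T (c i) z (v i) (B i)) :
    Function.Injective v := by
  intro i j hij
  by_contra hne
  exact Set.disjoint_left.1 (J.disjoint hne) (hc i).root_mem (hij ▸ (hc j).root_mem)

theorem update (J : Junction T x z v B) (hc : ∀ i, HasShape T (c i) z (v i) (B i)) {i : Fin k}
    {K : Set ℕ} (h : LocalChange T (B i) T' K) : Junction T' x z v (Function.update B i K) where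
  adj_iff w := by
    rw [h.adj_iff z (hc i).adj_parent.snd_mem (J.notMem i), J.adj_iff]
  notMem j := by
    rcases eq_or_ne j i with rfl | hj
    · rw [Function.update_self, h.mem_iff z (hc j).adj_parent.snd_mem]
      exact J.notMem j
    · rw [Function.update_of_ne hj]
      exact J.notMem j
  disjoint := by
    have hK {j : Fin k} (hj : j ≠ i) : Disjoint K (B j) := Set.disjoint_right.2 fun u hu => by
      rw [h.mem_iff u ((hc j).subset hu)]
      exact Set.disjoint_left.1 (J.disjoint hj) hu
    intro j l hjl
    rcases eq_or_ne j i with rfl | hj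
    · rw [Function.update_self, Function.update_of_ne hjl.symm]
      exact hK hjl.symm
    · rw [Function.update_of_ne hj]
      rcases eq_or_ne l i with rfl | hl
      · rw [Function.update_self]
        exact (hK hj).symm
      · rw [Function.update_of_ne hl]
        exact J.disjoint hjl

theorem hasShape_update (J : Junction T x z v B) (hc : ∀ i, HasShape T (c i) z (v i) (B i))
    {i : Fin k} {K : Set ℕ} {t : Tree} (h : LocalChange T (B i) T' K)
    (ht : HasShape T' t z (v i) K) :
    HasShape T' (.node k (Function.update c i t)) x z
      (insert z (⋃ j, (Function.update B i K j))) := by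
  refine .node (J.update hc h) fun j => ?_
  rcases eq_or_ne j i with rfl | hj
  · simpa only [Function.update_self] using ht
  · simp only [Function.update_of_ne hj]
    exact (hc j).congr fun u hu =>
      h.adj_iff u ((hc j).subset hu) (Set.disjoint_left.1 (J.disjoint hj) hu)

theorem grow {s : State} (J : Junction s.tree x s.pos v B) (hB : ∀ i, B i ⊆ s.tree.verts) :
    Junction s.grow.tree x s.pos (Fin.snoc v s.fresh : Fin (k + 1) → ℕ)
      (Fin.snoc B {s.fresh} : Fin (k + 1) → Set ℕ) where
  adj_iff w := by
    have hne := s.pos_ne_fresh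
    simp only [State.grow_adj, J.adj_iff, Fin.exists_fin_succ', Fin.snoc_castSucc, Fin.snoc_last]
    grind
  notMem := by
    simp only [Fin.forall_fin_succ', Fin.snoc_castSucc, Fin.snoc_last]
    exact ⟨J.notMem, s.pos_ne_fresh⟩
  disjoint := by
    have hfresh (i : Fin k) : s.fresh ∉ B i := fun h => s.fresh_notMem (hB i h)
    intro i j
    induction i using Fin.lastCases with
    | last =>
      induction j using Fin.lastCases with
      | last => exact fun h => absurd rfl h
      | cast j => simp [hfresh]
    | cast i =>
      induction j using Fin.lastCases with
      | last => simp [hfresh]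
      | cast j =>
        simp only [Fin.snoc_castSucc]
        exact fun hij => J.disjoint fun h => hij (congrArg _ h)

end Junction

theorem HasShape.grow {s : State} {k : ℕ} {c : Fin k → Tree} {x : ℕ} {L : Set ℕ}
    (h : HasShape s.tree (.node k c) x s.pos L) :
    HasShape s.grow.tree (.node (k + 1) (Fin.snoc c Tree.leaf : Fin (k + 1) → Tree)) x s.pos
      (insert s.fresh L) := by
  obtain @⟨_, _, _, _, v, B, J, hc⟩ := h
  have hL : insert s.fresh (insert s.pos (⋃ i, B i)) =
      insert s.pos (⋃ i, (Fin.snoc B {s.fresh} : Fin (k + 1) → Set ℕ) i) := by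
    ext u
    simp only [Set.mem_insert_iff, Set.mem_iUnion, Fin.exists_fin_succ', Fin.snoc_castSucc,
      Fin.snoc_last, Set.mem_singleton_iff]
    tauto
  rw [hL]
  refine .node (J.grow fun i => (hc i).subset) fun i => ?_
  induction i using Fin.lastCases with
  | last => simpa only [Fin.snoc_last] using HasShape.fresh s
  | cast i =>
    simp only [Fin.snoc_castSucc]
    refine (hc i).congr fun u hu => (LocalChange.grow rfl).adj_iff u ((hc i).subset hu) ?_
    rintro rfl
    exact J.notMem i hu

theorem State.jumpAvg_eq_departMean {s : State} {x k : ℕ} {v : Fin k → ℕ}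
    (hadj : ∀ w, s.tree.Adj s.pos w ↔ w = x ∨ ∃ i, v i = w) (hx : ∀ i, v i ≠ x)
    (hv : Function.Injective v) (g : State → ℝ) :
    s.jumpAvg g = departMean (g (s.goto x)) fun i => g (s.goto (v i)) := by
  have hx' : x ∉ Finset.univ.map ⟨v, hv⟩ := by simpa using hx
  have hnb : s.nb = insert x (Finset.univ.map ⟨v, hv⟩) := by
    ext w
    simp [hadj]
  rw [jumpAvg_of_nonempty s (hnb ▸ Finset.insert_nonempty _ _), hnb, Finset.sum_insert hx',
    Finset.card_insert_of_notMem hx', Finset.card_map, Finset.card_univ, Fintype.card_fin,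
    Finset.sum_map, departMean, smul_eq_mul]
  push_cast
  rfl

/-- Whenever the walker is at `x`, and the tree `T` has changed only in the branch `L` at `z`, the
function `κ` of the shape of this branch bounds the function `g` of the state. -/
def ExitLE (T : (⊤ : SimpleGraph ℕ).Subgraph) (x z : ℕ) (L : Set ℕ) (g : State → ℝ)
    (κ : Tree → ℝ) : Prop :=
  ∀ (s : State) (t : Tree) (L' : Set ℕ), s.pos = x → HasShape s.tree t x z L' →
    LocalChange T L s.tree L' → g s ≤ κ t

/-- The functionals `F` bound the law of the shape of a branch when the walker, started at its root,
first leaves it, if this happens within `n` steps. -/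
def ExcursionLE (p : unitInterval) (n : ℕ) (F : Tree → (Tree → ℝ) →ₗ[ℝ] ℝ) : Prop :=
  ∀ ⦃s : State⦄ ⦃t : Tree⦄ ⦃x : ℕ⦄ ⦃L : Set ℕ⦄ ⦃g : State → ℝ⦄ ⦃κ : Tree → ℝ⦄,
    HasShape s.tree t x s.pos L → x ∉ L → 0 ≤ g → 0 ≤ κ → ExitLE s.tree x s.pos L g κ →
      hit p x n s g ≤ F t κ

theorem ExitLE.localChange {T T' : (⊤ : SimpleGraph ℕ).Subgraph} {x z : ℕ} {L L' : Set ℕ}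
    {g : State → ℝ} {κ : Tree → ℝ} (h : ExitLE T x z L g κ) (hT : LocalChange T L T' L') :
    ExitLE T' x z L' g κ :=
  fun s t _ hs ht h' => h s t _ hs ht (hT.trans h')

section Excursion

variable {p : unitInterval} {n k x : ℕ} {s : State} {g : State → ℝ} {κ : Tree → ℝ}
  {R F : Tree → (Tree → ℝ) →ₗ[ℝ] ℝ}

theorem excursionLE_zero (hF : ∀ t, IsSubmean (F t)) : ExcursionLE p 0 F := by
  intro s t x L g κ ht hx _ hκ _
  rw [hit_zero_of_pos_ne (by rintro rfl; exact hx ht.root_mem)]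
  exact (hF t).nonneg hκ

/-- On its way from a child back to `x`, the walker visits the root again. -/
theorem Junction.hit_goto_child_le {v : Fin k → ℕ} {B : Fin k → Set ℕ} {c : Fin k → Tree}
    (J : Junction s.tree x s.pos v B) (hc : ∀ i, HasShape s.tree (c i) s.pos (v i) (B i))
    (hx : x ∉ insert s.pos (⋃ i, B i)) (hR : ExcursionLE p n R) (hF : ExcursionLE p n F)
    (hFmean : ∀ t, IsSubmean (F t)) (hg : 0 ≤ g) (hκ : 0 ≤ κ)
    (hexit : ExitLE s.tree x s.pos (insert s.pos (⋃ i, B i)) g κ) (i : Fin k) :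
    hit p x n (s.goto (v i)) g ≤ R (c i) fun t => F (.node k (Function.update c i t)) κ := by
  have hxmem : x ∈ s.tree.verts := ((J.adj_iff x).2 (.inl rfl)).snd_mem
  have hxi : x ∉ B i := fun h => hx (.inr (Set.mem_iUnion_of_mem i h))
  have hpos : (s.goto (v i)).pos = v i := s.goto_pos ((J.adj_iff _).2 (.inr ⟨i, rfl⟩))
  have hshape : HasShape (s.goto (v i)).tree (c i) s.pos (s.goto (v i)).pos (B i) := by
    rw [State.goto_tree, hpos]
    exact hc i
  have hback : ExitLE (s.goto (v i)).tree s.pos (s.goto (v i)).pos (B i)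
      (fun s' => hit p x n s' g) fun t => F (.node k (Function.update c i t)) κ := by
    rw [State.goto_tree, hpos]
    intro s' t' K hs' ht' hchange
    have hlocal := hchange.insert_iUnion s.pos
    refine hF (hs' ▸ J.hasShape_update hc hchange ht') ?_ hg hκ (hs' ▸ hexit.localChange hlocal)
    rwa [hs', hlocal.mem_iff x hxmem]
  calc hit p x n (s.goto (v i)) g
      ≤ hit p s.pos n (s.goto (v i)) fun s' => hit p x n s' g :=
        (hshape.isBranch (J.notMem i)).hit_le_hit hg le_rfl hshape.root_mem
          (by rw [State.goto_tree]; exact s.pos_mem) (by rwa [State.goto_tree]) hxi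
    _ ≤ R (c i) fun t => F (.node k (Function.update c i t)) κ :=
        hR hshape (J.notMem i) (fun s' => (isSubmean_hit n s').nonneg hg)
          (fun t => (hFmean _).nonneg hκ) hback

theorem HasShape.jumpAvg_hit_le {c : Fin k → Tree} {L : Set ℕ}
    (h : HasShape s.tree (.node k c) x s.pos L) (hx : x ∉ L) (hR : ExcursionLE p n R)
    (hF : ExcursionLE p n F) (hFmean : ∀ t, IsSubmean (F t)) (hg : 0 ≤ g) (hκ : 0 ≤ κ)
    (hexit : ExitLE s.tree x s.pos L g κ) :
    s.jumpAvg (fun s' => hit p x n s' g) ≤ departMean (κ (.node k c))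
      fun i => R (c i) fun t => F (.node k (Function.update c i t)) κ := by
  have hadj : s.tree.Adj s.pos x := h.adj_parent
  have hgx : g (s.goto x) ≤ κ (.node k c) := by
    refine hexit _ _ L (s.goto_pos hadj) ?_ ?_
    · rwa [State.goto_tree]
    · rw [State.goto_tree]
      exact .refl _ _
  obtain @⟨_, _, _, _, v, B, J, hc⟩ := h
  have hvx (i : Fin k) : v i ≠ x := fun h =>
    hx (.inr (Set.mem_iUnion_of_mem i (h ▸ (hc i).root_mem)))
  rw [State.jumpAvg_eq_departMean J.adj_iff hvx (J.injective hc),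
    hit_of_pos_eq (s.goto_pos hadj)]
  exact departMean_mono hgx (J.hit_goto_child_le hc hx hR hF hFmean hg hκ hexit)

theorem ExcursionLE.loop_succ {m : ℕ} (hR : ExcursionLE p n R) (hRmean : ∀ t, IsSubmean (R t))
    (hF : ExcursionLE p n (loop p R m)) : ExcursionLE p (n + 1) (loop p R (m + 1)) := by
  intro s t x L g κ ht hx hg hκ hexit
  obtain ⟨k, c⟩ := t
  have hFmean := isSubmean_loop (p := p) hRmean m
  have hxgrow : x ∉ insert s.fresh L := by
    rintro (h | h)
    exacts [s.fresh_ne ht.adj_parent.snd_mem h, hx h]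
  have hstay := ht.jumpAvg_hit_le hx hR hF hFmean hg hκ hexit
  have hgrow := ht.grow.jumpAvg_hit_le (s := s.grow) hxgrow hR hF hFmean hg hκ
    (hexit.localChange (.grow ht.root_mem))
  rw [hit_succ_of_pos_ne (by rintro rfl; exact hx ht.root_mem), loop, growMean_linearMap_apply,
    State.stepAvg_apply, add_comm]
  simp only [departMean_linearMap_apply]
  exact add_le_add (mul_le_mul_of_nonneg_left hstay (sub_nonneg.2 p.2.2))
    (mul_le_mul_of_nonneg_left hgrow p.2.1)

theorem excursionLE_loop {N h m : ℕ} (hh : n ≤ h) (hm : n ≤ m) (hN : n ≤ N) :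
    ExcursionLE p n (loop p (excursion p N h) m) := by
  induction n generalizing h m with
  | zero => exact excursionLE_zero (isSubmean_loop (isSubmean_excursion N h) m)
  | succ n ih =>
    obtain ⟨m, rfl⟩ : ∃ m', m = m' + 1 := ⟨m - 1, by omega⟩
    obtain ⟨h, rfl⟩ : ∃ h', h = h' + 1 := ⟨h - 1, by omega⟩
    have hR : ExcursionLE p n (excursion p N (h + 1)) := ih (by omega) (by omega) (by omega)
    exact hR.loop_succ (isSubmean_excursion N (h + 1)) (ih (by omega) (by omega) (by omega))

end Excursion

theorem exists_hit_goto_fresh_le {p₀ : ℝ} (hp0 : 0 < p₀) :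
    ∃ q < 1, ∀ p : unitInterval, p₀ ≤ p → ∀ n (s : State),
      hit p s.pos n (s.grow.goto s.fresh) 1 ≤ q := by
  obtain ⟨q, hq1, hq⟩ := exists_excursion_leaf_le hp0
  refine ⟨q, hq1, fun p hp n s => (hq p hp n (n + 1)).trans' ?_⟩
  have hadj : s.grow.tree.Adj s.grow.pos s.fresh := by simp [State.grow_adj]
  have hshape : HasShape (s.grow.goto s.fresh).tree Tree.leaf s.pos (s.grow.goto s.fresh).pos
      {s.fresh} := by
    rw [State.goto_tree, State.goto_pos _ hadj]
    exact .fresh s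
  exact excursionLE_loop le_rfl le_rfl le_rfl hshape s.pos_ne_fresh zero_le_one zero_le_one
    fun _ _ _ _ _ _ => le_rfl

/-! ### Escape from a neighbour -/

theorem State.jumpAvg_le_of_adj (s : State) {g : State → ℝ} {a b : ℝ} {y : ℕ}
    (hy : s.tree.Adj s.pos y) (ha : g (s.goto y) ≤ a)
    (hb : ∀ v, s.tree.Adj s.pos v → v ≠ y → g (s.goto v) ≤ b) :
    s.jumpAvg g ≤ b + (a - b) / s.nb.card := by
  have hyn : y ∈ s.nb := (s.mem_nb y).2 hy
  have hcard : (0 : ℝ) < s.nb.card := by exact_mod_cast Finset.card_pos.2 ⟨y, hyn⟩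
  have hrest : ∑ v ∈ s.nb.erase y, g (s.goto v) ≤ (s.nb.erase y).card • b :=
    Finset.sum_le_card_nsmul _ _ _ fun v hv =>
      hb v ((s.mem_nb v).1 (Finset.mem_of_mem_erase hv)) (Finset.ne_of_mem_erase hv)
  rw [nsmul_eq_mul, Finset.cast_card_erase_of_mem hyn] at hrest
  calc s.jumpAvg g = (s.nb.card : ℝ)⁻¹ * (g (s.goto y) + ∑ v ∈ s.nb.erase y, g (s.goto v)) := by
        rw [s.jumpAvg_of_nonempty ⟨y, hyn⟩, Finset.add_sum_erase s.nb (fun v => g (s.goto v)) hyn]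
    _ ≤ (s.nb.card : ℝ)⁻¹ * (a + (s.nb.card - 1) * b) := by gcongr
    _ = b + (a - b) / s.nb.card := by field_simp; ring

section Escape

variable {p : unitInterval} {n : ℕ} {s : State} {y v : ℕ} {q r : ℝ}

theorem hit_one_le_one (n : ℕ) (s : State) : hit p y n s 1 ≤ 1 := (isSubmean_hit n s).map_one_le

theorem IsBranch.hit_one_le_mul {L : Set ℕ} {b : ℝ} (h : IsBranch s.tree L v) (hs : s.pos ∈ L)
    (hv : v ∈ s.tree.verts) (hy : y ∈ s.tree.verts) (hyL : y ∉ L)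
    (hb : ∀ t : State, t.pos = v → s.tree ≤ t.tree → hit p y n t 1 ≤ b) :
    hit p y n s 1 ≤ b * hit p v n s 1 :=
  (h.hit_le_hit zero_le_one le_rfl hs hv hy hyL).trans (hit_le n s hb)

theorem hit_goto_le_sq (hr : 0 ≤ r)
    (h : ∀ (s : State) (y : ℕ), s.tree.Adj s.pos y → hit p y n s 1 ≤ r)
    (hy : s.tree.Adj s.pos y) (hv : s.tree.Adj s.pos v) (hvy : v ≠ y) :
    hit p y n (s.goto v) 1 ≤ r ^ 2 := by
  have htree := s.goto_tree v
  have hvs : (s.goto v).tree.Adj v s.pos := htree ▸ hv.symm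
  obtain ⟨L, hL, hvL, hyL⟩ := (s.goto v).exists_isBranch hvs
  have hreach : ((s.goto v).tree.spanningCoe.deleteEdges {s(v, s.pos)}).Reachable s.pos y := by
    refine SimpleGraph.Adj.reachable (SimpleGraph.deleteEdges_adj.2 ⟨htree ▸ hy, fun he => ?_⟩)
    rcases Sym2.eq_iff.1 he with ⟨he, -⟩ | ⟨-, he⟩
    exacts [hv.ne he, hvy he.symm]
  calc hit p y n (s.goto v) 1 ≤ r * hit p s.pos n (s.goto v) 1 :=
        hL.hit_one_le_mul ((s.goto_pos hv).symm ▸ hvL) (htree ▸ s.pos_mem) (htree ▸ hy.snd_mem)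
          (hyL y hreach) fun t ht hst => h t y (ht ▸ (htree ▸ hst).2 hy)
    _ ≤ r * r := by
        gcongr
        exact h _ _ ((s.goto_pos hv).symm ▸ hvs)
    _ = r ^ 2 := (sq r).symm

theorem jumpAvg_hit_le_of_three_le_card (hr : 1 / 2 ≤ r) (hr1 : r ≤ 1)
    (h : ∀ (s : State) (y : ℕ), s.tree.Adj s.pos y → hit p y n s 1 ≤ r)
    (hy : s.tree.Adj s.pos y) (hcard : 3 ≤ s.nb.card) :
    s.jumpAvg (fun t => hit p y n t 1) ≤ r :=
  calc s.jumpAvg (fun t => hit p y n t 1) ≤ r ^ 2 + (1 - r ^ 2) / s.nb.card :=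
        s.jumpAvg_le_of_adj hy (hit_one_le_one n _) fun _ hv hvy =>
          hit_goto_le_sq (by linarith) h hy hv hvy
    _ ≤ r ^ 2 + (1 - r ^ 2) / 3 := by
        have : 0 ≤ 1 - r ^ 2 := by nlinarith
        gcongr
        exact_mod_cast hcard
    _ ≤ r := by nlinarith

theorem hit_goto_fresh_le (hq : ∀ s : State, hit p s.pos n (s.grow.goto s.fresh) 1 ≤ q)
    (hy : y ∈ s.tree.verts) : hit p y n (s.grow.goto s.fresh) 1 ≤ q := by
  have htree := s.grow.goto_tree s.fresh
  have hadj : s.grow.tree.Adj s.grow.pos s.fresh := (s.grow_adj _ _).2 (.inr (.inl ⟨rfl, rfl⟩))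
  have hbranch := (HasShape.fresh s).isBranch s.pos_ne_fresh
  rw [← htree] at hbranch
  calc hit p y n (s.grow.goto s.fresh) 1 ≤ 1 * hit p s.pos n (s.grow.goto s.fresh) 1 :=
        hbranch.hit_one_le_mul (s.grow.goto_pos hadj) (htree ▸ s.le_grow.1 s.pos_mem)
          (htree ▸ s.le_grow.1 hy) (s.fresh_ne hy) fun t _ _ => hit_one_le_one n t
    _ ≤ q := (one_mul _).trans_le (hq s)

theorem stepAvg_hit_le_of_card_le_two (hq1 : q ≤ 1)
    (hq : ∀ s : State, hit p s.pos n (s.grow.goto s.fresh) 1 ≤ q)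
    (hy : y ∈ s.tree.verts) (hcard : s.nb.card ≤ 2) :
    s.stepAvg p (fun t => hit p y n t 1) ≤ 1 - p * (1 - q) / 3 := by
  have hstay : s.jumpAvg (fun t => hit p y n t 1) ≤ 1 :=
    (s.jumpAvg_mono fun v => hit_one_le_one n _).trans_eq s.jumpAvg_one
  have hgrow : s.grow.jumpAvg (fun t => hit p y n t 1) ≤ 1 - (1 - q) / 3 :=
    calc s.grow.jumpAvg (fun t => hit p y n t 1) ≤ 1 + (q - 1) / s.grow.nb.card :=
          s.grow.jumpAvg_le_of_adj ((s.grow_adj _ _).2 (.inr (.inl ⟨rfl, rfl⟩)))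
            (hit_goto_fresh_le hq hy) fun _ _ _ => hit_one_le_one n _
      _ = 1 - (1 - q) / (s.nb.card + 1) := by
          rw [s.nb_grow, Finset.card_insert_of_notMem s.fresh_notMem_nb]
          push_cast
          ring
      _ ≤ 1 - (1 - q) / 3 := by
          have : (s.nb.card : ℝ) ≤ 2 := by exact_mod_cast hcard
          gcongr
          linarith
  rw [State.stepAvg_apply]
  linarith [mul_le_mul_of_nonneg_left hgrow p.2.1,
    mul_le_mul_of_nonneg_left hstay (sub_nonneg.2 p.2.2)]

/-- At a vertex with at most two neighbours, the walker disappears into a new leaf with probability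
bounded below; otherwise most of its moves lead it to distance two from `y`. -/
theorem hit_le_of_adj (hq1 : q ≤ 1)
    (hq : ∀ n (s : State), hit p s.pos n (s.grow.goto s.fresh) 1 ≤ q)
    (hr : 1 / 2 ≤ r) (hr1 : r ≤ 1) (hqr : 1 - p * (1 - q) / 3 ≤ r) (n : ℕ) (s : State) (y : ℕ)
    (hy : s.tree.Adj s.pos y) : hit p y n s 1 ≤ r := by
  induction n generalizing s y with
  | zero => exact (hit_zero_of_pos_ne hy.ne 1).trans_le (by linarith)
  | succ n ih =>
    rw [hit_succ_of_pos_ne hy.ne]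
    rcases le_or_gt s.nb.card 2 with hcard | hcard
    · exact (stepAvg_hit_le_of_card_le_two hq1 (hq n) hy.snd_mem hcard).trans hqr
    · have hstay := jumpAvg_hit_le_of_three_le_card hr hr1 ih hy hcard
      have hgrow := jumpAvg_hit_le_of_three_le_card hr hr1 ih (s.le_grow.2 hy) <|
        hcard.trans_le (Finset.card_le_card (s.nb_grow ▸ Finset.subset_insert _ _))
      rw [State.stepAvg_apply]
      linarith [mul_le_mul_of_nonneg_left hgrow p.2.1,
        mul_le_mul_of_nonneg_left hstay (sub_nonneg.2 p.2.2)]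

theorem exists_hit_le_of_adj {p₀ : ℝ} (hp₀ : 0 < p₀) : ∃ r, 0 ≤ r ∧ r < 1 ∧
    ∀ p : unitInterval, p₀ ≤ p → ∀ n (s : State) (y : ℕ), s.tree.Adj s.pos y →
      hit p y n s 1 ≤ r := by
  obtain ⟨q, hq1, hq⟩ := exists_hit_goto_fresh_le hp₀
  have hpos : 0 < p₀ * (1 - q) := mul_pos hp₀ (sub_pos.2 hq1)
  have hr1 : max (1 / 2) (1 - p₀ * (1 - q) / 3) < 1 := max_lt (by norm_num) (by linarith)
  refine ⟨_, le_max_of_le_left one_half_pos.le, hr1, fun p hp => ?_⟩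
  refine hit_le_of_adj hq1.le (hq p hp) (le_max_left _ _) hr1.le (le_max_of_le_right ?_)
  gcongr

/-! ### Distances -/

theorem hit_le_pow (hr : 0 ≤ r)
    (h : ∀ n (s : State) (y : ℕ), s.tree.Adj s.pos y → hit p y n s 1 ≤ r) (n : ℕ)
    {s₀ : State} {u y : ℕ} (w : s₀.tree.spanningCoe.Walk u y) (hw : w.IsPath)
    (hy : y ∈ s₀.tree.verts) (s : State) (hs : s₀.tree ≤ s.tree) (hu : s.pos = u) :
    hit p y n s 1 ≤ r ^ w.length := by
  induction w generalizing s with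
  | nil => exact (hit_one_le_one n s).trans_eq (pow_zero r).symm
  | @cons u v y huv w ih =>
    rw [SimpleGraph.Walk.cons_isPath_iff] at hw
    have huv' : s.tree.Adj u v := hs.2 huv
    obtain ⟨L, hL, huL, hyL⟩ := s.exists_isBranch huv'
    have hreach : (s.tree.spanningCoe.deleteEdges {s(u, v)}).Reachable v y := by
      have hmem : s(u, v) ∉ w.edges := fun h => hw.2 (w.fst_mem_support_of_mem_edges h)
      exact (w.toDeleteEdge _ hmem).reachable.mono (SimpleGraph.deleteEdges_mono hs.2)
    calc hit p y n s 1 ≤ r ^ w.length * hit p v n s 1 :=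
          hL.hit_one_le_mul (hu ▸ huL) huv'.snd_mem (hs.1 hy) (hyL y hreach)
            fun t ht hst => ih hw.1 hy t (hs.trans hst) ht
      _ ≤ r ^ w.length * r := by
          gcongr
          exact h n s v (hu ▸ huv')
      _ = r ^ (SimpleGraph.Walk.cons huv w).length := (pow_succ r _).symm

theorem State.exists_isPath_dist (s : State) {x y : ℕ} (hx : x ∈ s.tree.verts)
    (hy : y ∈ s.tree.verts) :
    ∃ w : s.tree.spanningCoe.Walk x y, w.IsPath ∧ w.length = s.dist x y :=
  ((s.connected.preconnected.coe ⟨x, hx⟩ ⟨y, hy⟩).map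
    (⟨Subtype.val, id⟩ : s.tree.coe →g s.tree.spanningCoe)).exists_path_of_dist

theorem hit_le_pow_dist (hr : 0 ≤ r)
    (h : ∀ n (s : State) (y : ℕ), s.tree.Adj s.pos y → hit p y n s 1 ≤ r) (n : ℕ) (s : State)
    (hy : y ∈ s.tree.verts) : hit p y n s 1 ≤ r ^ s.dist s.pos y := by
  obtain ⟨w, hw, hlen⟩ := s.exists_isPath_dist s.pos_mem hy
  exact hlen ▸ hit_le_pow hr h n w hw hy s le_rfl rfl

end Escape

/-! ### Visits -/

/-- The probability of at least `k` visits to `y` at the times before `n`. -/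
def visitProb (p : unitInterval) (y : ℕ) : ℕ → ℕ → State → ℝ
  | _, 0, _ => 1
  | 0, _ + 1, _ => 0
  | n + 1, k + 1, s => s.stepAvg p (visitProb p y n (if s.pos = y then k else k + 1))

section Visits

variable {p : unitInterval} {y : ℕ} {r ρ : ℝ}

theorem visitProb_zero_right (n : ℕ) (s : State) : visitProb p y n 0 s = 1 := by
  cases n <;> rfl

theorem visitProb_nonneg (n k : ℕ) (s : State) : 0 ≤ visitProb p y n k s := by
  induction n generalizing k s with
  | zero => cases k <;> simp [visitProb]
  | succ n ih =>
    cases k with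
    | zero => exact zero_le_one
    | succ k => exact s.isSubmean_stepAvg.nonneg fun t => ih _ t

theorem visitProb_succ_le (hρ : 0 ≤ ρ)
    (h : ∀ n (s : State), s.pos = y → s.stepAvg p (fun t => hit p y n t 1) ≤ ρ) (n k : ℕ)
    (s : State) : visitProb p y n (k + 1) s ≤ ρ ^ k * hit p y n s 1 := by
  induction n generalizing k s with
  | zero => exact mul_nonneg (pow_nonneg hρ k) ((isSubmean_hit 0 s).nonneg zero_le_one)
  | succ n ih =>
    have hscale (k : ℕ) : s.stepAvg p (visitProb p y n (k + 1)) ≤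
        ρ ^ k * s.stepAvg p fun t => hit p y n t 1 :=
      (s.stepAvg_mono fun t _ => ih k t).trans_eq
        (map_smul (s.stepAvg p) (ρ ^ k) fun t => hit p y n t 1)
    rw [visitProb]
    by_cases hs : s.pos = y
    · rw [if_pos hs, hit_of_pos_eq hs, Pi.one_apply, mul_one]
      cases k with
      | zero =>
        exact (s.stepAvg_mono fun t _ => (visitProb_zero_right n t).le).trans_eq s.stepAvg_one
      | succ k =>
        refine (hscale k).trans ?_
        rw [pow_succ]
        gcongr
        exact h n s hs
    · rw [if_neg hs, hit_succ_of_pos_ne hs]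
      exact hscale k

theorem stepAvg_hit_pos_le {n : ℕ}
    (h : ∀ (s : State) (y : ℕ), s.tree.Adj s.pos y → hit p y n s 1 ≤ r) (s : State) :
    s.stepAvg p (fun t => hit p s.pos n t 1) ≤ 1 - p * (1 - r) := by
  have hback (v : ℕ) (hv : s.grow.tree.Adj s.pos v) : hit p s.pos n (s.grow.goto v) 1 ≤ r :=
    h _ _ (by rw [State.goto_tree, State.goto_pos _ hv]; exact hv.symm)
  have hfresh : s.grow.tree.Adj s.pos s.fresh := (s.grow_adj _ _).2 (.inr (.inl ⟨rfl, rfl⟩))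
  have hgrow : s.grow.jumpAvg (fun t => hit p s.pos n t 1) ≤ r :=
    (s.grow.jumpAvg_le_of_adj hfresh (hback _ hfresh) fun v hv _ => hback v hv).trans_eq (by simp)
  have hstay : s.jumpAvg (fun t => hit p s.pos n t 1) ≤ 1 :=
    (s.jumpAvg_mono fun v => hit_one_le_one n _).trans_eq s.jumpAvg_one
  rw [State.stepAvg_apply]
  linarith [mul_le_mul_of_nonneg_left hgrow p.2.1,
    mul_le_mul_of_nonneg_left hstay (sub_nonneg.2 p.2.2)]

theorem exists_visitProb_le {p₀ : ℝ} (hp₀ : 0 < p₀) : ∃ ρ, 0 < ρ ∧ ρ < 1 ∧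
    ∀ p : unitInterval, p₀ ≤ p → ∀ n (s : State), ∀ y ∈ s.tree.verts,
      (∀ k, visitProb p y n (k + 1) s ≤ ρ ^ k) ∧ visitProb p y n 1 s ≤ ρ ^ s.dist s.pos y := by
  obtain ⟨r, hr0, hr1, hr⟩ := exists_hit_le_of_adj hp₀
  have hpos : 0 < p₀ * (1 - r) := mul_pos hp₀ (sub_pos.2 hr1)
  set ρ := max (1 / 2) (max r (1 - p₀ * (1 - r)))
  have hρ0 : 0 < ρ := lt_max_of_lt_left one_half_pos
  have hrρ : r ≤ ρ := le_max_of_le_right (le_max_left _ _)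
  have hρ1 : ρ < 1 := max_lt one_half_lt_one (max_lt hr1 (by linarith))
  refine ⟨ρ, hρ0, hρ1, fun p hp n s y hy => ?_⟩
  have hreturn (n : ℕ) (t : State) (ht : t.pos = y) :
      t.stepAvg p (fun u => hit p y n u 1) ≤ ρ := by
    subst ht
    refine (stepAvg_hit_pos_le (hr p hp n) t).trans
      (le_max_of_le_right (le_max_of_le_right ?_))
    gcongr
  have hvisit (k : ℕ) := visitProb_succ_le hρ0.le hreturn n k s
  refine ⟨fun k => (hvisit k).trans
    (mul_le_of_le_one_right (pow_nonneg hρ0.le k) (hit_one_le_one n s)), ?_⟩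
  calc visitProb p y n 1 s ≤ hit p y n s 1 := by simpa using hvisit 0
    _ ≤ r ^ s.dist s.pos y := hit_le_pow_dist hr0 (hr p hp) n s hy
    _ ≤ ρ ^ s.dist s.pos y := by gcongr

end Visits

/-! ### The law of the trajectory -/

theorem lintegral_law_le (p : unitInterval) (s : State) (n : ℕ) {φ : ℕ → (ℕ → State) → ENNReal}
    (hφ : ∀ t, Measurable (φ t)) (hdep : DependsOn (φ n) (Set.Iic n))
    (hstep : ∀ t < n, ∀ ω, ∫⁻ x, φ (t + 1) (Function.update ω (t + 1) x) ∂step p (ω t) ≤ φ t ω) :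
    ∫⁻ ω, φ n ω ∂law p s ≤ φ 0 fun _ => s := by
  set κ : (n : ℕ) → Kernel ((_ : Finset.Iic n) → State) State := fun n =>
    (kernel p).comap (fun h => h ⟨n, Finset.mem_Iic.2 le_rfl⟩) (measurable_pi_apply _)
  have hlaw : ∫⁻ ω, φ n ω ∂law p s =
      Kernel.lmarginalPartialTraj (X := fun _ => State) κ 0 n (φ n) fun _ => s := by
    rw [Kernel.lmarginalPartialTraj, ← Kernel.traj_map_frestrictLe_apply, lintegral_map]
    · refine lintegral_congr fun ω => hdep fun i hi => ?_
      simp [Function.updateFinset, Set.mem_Iic.1 hi]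
    · exact (hφ n).comp measurable_updateFinset
    · fun_prop
  have hanti (t : ℕ) (ht : t ≤ n) :
      Kernel.lmarginalPartialTraj (X := fun _ => State) κ 0 t (φ t) (fun _ => s) ≤
        φ 0 fun _ => s := by
    induction t with
    | zero => rw [Kernel.lmarginalPartialTraj_le κ le_rfl (hφ 0)]
    | succ t ih =>
      refine le_trans ?_ (ih (by omega))
      rw [← Kernel.lmarginalPartialTraj_self t.zero_le t.le_succ (hφ (t + 1))]
      refine Kernel.lmarginalPartialTraj_mono 0 t (fun ω => ?_) _
      rw [Kernel.lmarginalPartialTraj_succ t (hφ (t + 1))]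
      exact hstep t (by omega) ω
  exact hlaw.trans_le (hanti n le_rfl)

/-- The number of visits to `y` at the times before `t`. -/
def visitsBefore (y t : ℕ) (ω : ℕ → State) : ℕ := Nat.count (fun i => (ω i).pos = y) t

section VisitsBefore

variable {p : unitInterval} {y : ℕ}

theorem visitsBefore_congr {t : ℕ} {ω ω' : ℕ → State} (h : ∀ i < t, ω i = ω' i) :
    visitsBefore y t ω = visitsBefore y t ω' := by
  simp only [visitsBefore, Nat.count_eq_card_filter_range]
  congr 1
  exact Finset.filter_congr fun i hi => by rw [h i (Finset.mem_range.1 hi)]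

theorem measurable_visitsBefore (t : ℕ) : Measurable (visitsBefore y t) := by
  unfold visitsBefore
  induction t with
  | zero => simpa only [Nat.count_zero] using measurable_const
  | succ t ih =>
    simp only [Nat.count_succ]
    exact ih.add <| (measurable_from_top (f := fun s : State => if s.pos = y then 1 else 0)).comp
      (measurable_pi_apply t)

theorem visitProb_succ_left (n k : ℕ) (s : State) :
    visitProb p y (n + 1) k s =
      s.stepAvg p (visitProb p y n (k - if s.pos = y then 1 else 0)) := by
  cases k with
  | zero =>
    rw [visitProb_zero_right, Nat.zero_sub, ← s.stepAvg_one (p := p)]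
    exact congrArg _ (funext fun t => (visitProb_zero_right n t).symm)
  | succ k => by_cases hs : s.pos = y <;> simp [visitProb, hs]

theorem law_visitsBefore_le (s : State) (n k : ℕ) :
    law p s {ω | k ≤ visitsBefore y n ω} ≤ ENNReal.ofReal (visitProb p y n k s) := by
  -- the conditional probability of the event, given the first `t` steps
  set φ : ℕ → (ℕ → State) → ENNReal := fun t ω =>
    ENNReal.ofReal (visitProb p y (n - t) (k - visitsBefore y t ω) (ω t)) with hφ
  have hmeas (t : ℕ) : Measurable (φ t) := by
    have : Measurable fun x : ℕ × State =>
        ENNReal.ofReal (visitProb p y (n - t) (k - x.1) x.2) :=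
      measurable_from_prod_countable_right fun m => measurable_from_top
    exact this.comp ((measurable_visitsBefore t).prodMk (measurable_pi_apply t))
  have hdep : DependsOn (φ n) (Set.Iic n) := fun ω ω' h => by
    simp only [hφ, h n Set.self_mem_Iic,
      visitsBefore_congr (y := y) fun i hi => h i (Set.mem_Iic.2 (le_of_lt hi))]
  have hstep (t : ℕ) (ht : t < n) (ω : ℕ → State) :
      ∫⁻ x, φ (t + 1) (Function.update ω (t + 1) x) ∂step p (ω t) ≤ φ t ω := by
    have hcount (x : State) : visitsBefore y (t + 1) (Function.update ω (t + 1) x) =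
        visitsBefore y t ω + if (ω t).pos = y then 1 else 0 := by
      rw [visitsBefore_congr (ω' := ω) fun i hi => Function.update_of_ne hi.ne _ _, visitsBefore,
        Nat.count_succ, visitsBefore]
    simp only [hφ, hcount, Function.update_self, ← Nat.sub_sub]
    rw [lintegral_step p (ω t) (visitProb_nonneg _ _), ← visitProb_succ_left,
      Nat.sub_add_cancel (Nat.sub_pos_of_lt ht)]
  refine (meas_le_lintegral₀ (hmeas n).aemeasurable fun ω hω => ?_).trans <|
    (lintegral_law_le p s n hmeas hdep hstep).trans_eq (by simp [hφ, visitsBefore])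
  simp [hφ, Nat.sub_eq_zero_of_le (show k ≤ visitsBefore y n ω from hω), visitProb_zero_right]

theorem exists_le_visitsBefore {k : ℕ} {ω : ℕ → State} (h : k ≤ visits y ω) :
    ∃ n, k ≤ visitsBefore y n ω := by
  obtain ⟨S, hS, hk⟩ := Set.exists_subset_encard_eq h
  lift S to Finset ℕ using Set.finite_of_encard_eq_coe hk
  obtain ⟨n, hn⟩ := S.bddAbove
  rw [Set.encard_coe_eq_coe_finsetCard, Nat.cast_inj] at hk
  refine ⟨n + 1, ?_⟩
  rw [visitsBefore, Nat.count_eq_card_filter_range, ← hk]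
  exact Finset.card_le_card fun t ht => Finset.mem_filter.2
    ⟨Finset.mem_range_succ_iff.2 (hn ht), hS ht⟩

theorem law_visits_le {s : State} {k : ℕ} {b : ℝ} (h : ∀ n, visitProb p y n k s ≤ b) :
    (law p s).real {ω | (k : ℕ∞) ≤ visits y ω} ≤ b := by
  have hmono : Monotone fun n => {ω | k ≤ visitsBefore y n ω} := fun m n hmn ω hω =>
    le_trans hω (Nat.count_monotone _ hmn)
  have hsub : {ω | (k : ℕ∞) ≤ visits y ω} ⊆ ⋃ n, {ω | k ≤ visitsBefore y n ω} := fun ω hω =>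
    Set.mem_iUnion.2 (exists_le_visitsBefore hω)
  refine ENNReal.toReal_le_of_le_ofReal ((visitProb_nonneg 0 k s).trans (h 0)) ?_
  calc law p s {ω | (k : ℕ∞) ≤ visits y ω} ≤ ⨆ n, law p s {ω | k ≤ visitsBefore y n ω} :=
        (measure_mono hsub).trans_eq hmono.measure_iUnion
    _ ≤ ENNReal.ofReal b := iSup_le fun n =>
        (law_visitsBefore_le s n k).trans (ENNReal.ofReal_le_ofReal (h n))

end VisitsBefore

end BGRW

end

theorem mainTheorem7 :
    ∀ p₀ : ℝ, 0 < p₀ → p₀ ≤ 1 →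
      ∃ C β : ℝ, 0 < C ∧ 0 < β ∧
        ∀ p : unitInterval, p₀ ≤ (p : ℝ) →
          ∀ s : BGRW.State, ∀ y ∈ s.tree.verts,
            (∀ k : ℕ,
              (BGRW.law p s).real {ω | (k : ℕ∞) ≤ BGRW.visits y ω} ≤ C * Real.exp (-β * k)) ∧
            (BGRW.law p s).real {ω | 0 < BGRW.visits y ω} ≤
              C * Real.exp (-β * s.dist s.pos y) := by
  intro p₀ hp₀ _
  obtain ⟨ρ, hρ0, hρ1, hρ⟩ := BGRW.exists_visitProb_le hp₀
  have hexp (k : ℕ) : Real.exp (-(-Real.log ρ) * k) = ρ ^ k := by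
    rw [neg_neg, mul_comm, ← Real.log_pow, Real.exp_log (pow_pos hρ0 k)]
  have hone : 1 ≤ ρ⁻¹ := (one_le_inv₀ hρ0).2 hρ1.le
  refine ⟨ρ⁻¹, -Real.log ρ, inv_pos.2 hρ0, neg_pos.2 (Real.log_neg hρ0 hρ1),
    fun p hp s y hy => ⟨fun k => ?_, ?_⟩⟩
  · rw [hexp]
    refine BGRW.law_visits_le fun n => ?_
    cases k with
    | zero => simpa only [BGRW.visitProb_zero_right, pow_zero, mul_one] using hone
    | succ k => simpa only [pow_succ', inv_mul_cancel_left₀ hρ0.ne'] using (hρ p hp n s y hy).1 k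
  · rw [hexp]
    simp only [← Order.one_le_iff_pos, ← Nat.cast_one (R := ℕ∞)]
    exact BGRW.law_visits_le fun n =>
      (hρ p hp n s y hy).2.trans (le_mul_of_one_le_left (by positivity) hone)
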